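/- Let $\mathbb D$ be the open unit disc, $\mathbb T$ the unit circle and $m$ normalized Lebesgue measure on $\mathbb T$. An automorphism of $\mathbb D$ is a map $\gamma(z)=\lambda\frac{a-z}{1-\overline a z}$ with $|a|<1$, $|\lambda|=1$; it also acts on $\mathbb T$. Let $\Gamma$ be a group of automorphisms of $\mathbb D$. For $1\le p\le\infty$ let $H^p\subseteq L^p(\mathbb T,m)$ be the Hardy space (the functions whose Fourier coefficients of negative index vanish), and let $H^p_\Gamma=\{f\in H^p : f\circ\gamma=f \text{ $m$-a.e. for all }\gamma\in\Gamma\}$. Let $\Psi$ be the conditional expectation onto the $\sigma$-algebra of the measurable sets $E\subseteq\mathbb T$ with $m(E\,\triangle\,\gamma^{-1}(E))=0$ for all $\gamma\in\Gamma$, let $k_w(z)=\frac1{1-\overline w z}$ be the Szegő kernel, and let $N$ be the linear span of the functions $v_\gamma=-i\,\Psi\bigl(k_{\gamma(0)}-\overline{k_{\gamma(0)}}\bigr)$, $\gamma\in\Gamma$. Assume that $\Gamma$ is admissible, that is, $\Gamma$ is of convergence type, $\sum_{\gamma\in\Gamma}(1-|\gamma(0)|)<\infty$ (such a group is automatically discrete,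 i.e. Fuchsian), and $N$ is finite-dimensional. Then for every $1\le p<\infty$ $$[H^\infty_\Gamma]_p=H^p_\Gamma ,$$ where $[X]_p$ denotes the smallest closed linear subspace of $L^p(\mathbb T,m)$ that contains $X$. -/

import Mathlib

open MeasureTheory Complex
open scoped UnitDisc ENNReal ComplexConjugate

noncomputable section

namespace HardyFixed

/-! ### Automorphisms of the disc and their action on the circle -/

theorem denom_ne_zero (a : 𝔻) (z : ℂ) (hz : ‖z‖ ≤ 1) : 1 - conj (a : ℂ) * z ≠ 0 := by
  intro h
  have h1 : ‖conj (a : ℂ) * z‖ = 1 := by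
    rw [← sub_eq_zero.mp h, norm_one]
  rw [norm_mul, Complex.norm_conj] at h1
  nlinarith [a.norm_lt_one, norm_nonneg z, norm_nonneg (a : ℂ)]

/-- `g` acts on the closed disc by `z ↦ c (a - z) / (1 - conj a * z)` with `|c| = 1`, `|a| < 1`. -/
def IsMobius (g : Equiv.Perm 𝕔𝔻) : Prop :=
  ∃ (c : Circle) (a : 𝔻), ∀ z : 𝕔𝔻,
    (g z : ℂ) = (c : ℂ) * ((a : ℂ) - z) / (1 - conj (a : ℂ) * z)

theorem isMobius_one : IsMobius 1 := by
  refine ⟨⟨-1, by simp [Submonoid.unitSphere]⟩, 0, fun z => ?_⟩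
  simp

theorem circle_conj_mul (c : Circle) : conj (c : ℂ) * (c : ℂ) = 1 := by
  rw [mul_comm, Complex.mul_conj, Circle.normSq_coe, Complex.ofReal_one]

theorem IsMobius.inv {g : Equiv.Perm 𝕔𝔻} (hg : IsMobius g) : IsMobius g⁻¹ := by
  obtain ⟨c, a, h⟩ := hg
  refine ⟨c⁻¹, c • a, fun w => ?_⟩
  obtain ⟨z, rfl⟩ := g.surjective w
  have hz := denom_ne_zero a z z.norm_le_one
  have hw := denom_ne_zero (c • a) (g z) (g z).norm_le_one
  have hc := circle_conj_mul c
  have hc0 : (c : ℂ) ≠ 0 := Circle.coe_ne_zero c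
  rw [show g⁻¹ (g z) = z from g.symm_apply_apply z, eq_div_iff hw, Circle.coe_inv,
    UnitDisc.coe_circle_smul, h z, map_mul]
  generalize hb : conj (a : ℂ) = b at *
  generalize hD : 1 - b * (z : ℂ) = D at *
  field_simp
  linear_combination (-(z : ℂ) * b * (a - z)) * hc + ((a : ℂ) - z) * hD

theorem normSq_mobius (c : Circle) (a z : ℂ) :
    normSq (1 - conj a * z) - normSq ((c : ℂ) * (a - z)) = (1 - normSq a) * (1 - normSq z) := by
  rw [normSq_mul, Circle.normSq_coe]
  simp only [normSq_apply, sub_re, sub_im, mul_re, mul_im, conj_re, conj_im, one_re, one_im]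
  ring

theorem IsMobius.mul {g₁ g₂ : Equiv.Perm 𝕔𝔻} (h₁ : IsMobius g₁) (h₂ : IsMobius g₂) :
    IsMobius (g₁ * g₂) := by
  obtain ⟨c₁, a₁, h₁⟩ := h₁
  obtain ⟨c₂, a₂, h₂⟩ := h₂
  set u : ℂ := (c₂ : ℂ) - a₁ * conj (a₂ : ℂ) with hu
  have hc := circle_conj_mul c₂
  have hc0 : (c₂ : ℂ) ≠ 0 := Circle.coe_ne_zero c₂
  have key : normSq u - normSq ((c₂ : ℂ) * a₂ - a₁)
      = (1 - normSq (a₁ : ℂ)) * (1 - normSq (a₂ : ℂ)) := by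
    have e : normSq (c₂ : ℂ) = 1 := Circle.normSq_coe c₂
    rw [hu]
    simp only [normSq_apply, sub_re, sub_im, mul_re, mul_im, conj_re, conj_im] at e ⊢
    linear_combination (1 - ((a₂ : ℂ).re ^ 2 + (a₂ : ℂ).im ^ 2)) * e
  have hpos : 0 < (1 - normSq (a₁ : ℂ)) * (1 - normSq (a₂ : ℂ)) :=
    mul_pos (sub_pos.mpr a₁.normSq_lt_one) (sub_pos.mpr a₂.normSq_lt_one)
  have hu0 : u ≠ 0 := by
    intro h0
    rw [h0, normSq_zero] at key
    nlinarith [normSq_nonneg ((c₂ : ℂ) * a₂ - a₁)]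
  have hu0' : conj u ≠ 0 := (map_ne_zero _).mpr hu0
  have hb : ‖((c₂ : ℂ) * a₂ - a₁) / u‖ < 1 := by
    rw [norm_div, div_lt_one (norm_pos_iff.mpr hu0), Complex.norm_def, Complex.norm_def]
    exact Real.sqrt_lt_sqrt (normSq_nonneg _) (by linarith)
  have hd : ‖-(c₁ : ℂ) * u / (c₂ * conj u)‖ = 1 := by
    rw [norm_div, norm_mul, norm_mul, norm_neg, Circle.norm_coe, Circle.norm_coe,
      Complex.norm_conj, one_mul, div_self (norm_ne_zero_iff.mpr hu0)]
  refine ⟨⟨-(c₁ : ℂ) * u / (c₂ * conj u), mem_sphere_zero_iff_norm.mpr hd⟩,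
    UnitDisc.mk (((c₂ : ℂ) * a₂ - a₁) / u) hb, fun z => ?_⟩
  have hz := denom_ne_zero a₂ z z.norm_le_one
  have hw := denom_ne_zero a₁ (g₂ z) (g₂ z).norm_le_one
  have hv := denom_ne_zero (UnitDisc.mk (((c₂ : ℂ) * a₂ - a₁) / u) hb) z z.norm_le_one
  rw [Equiv.Perm.mul_apply, h₁, div_eq_div_iff hw hv, h₂, UnitDisc.coe_mk]
  have hcu : conj u = conj (c₂ : ℂ) - conj (a₁ : ℂ) * a₂ := by simp [hu]
  change _ = (-(c₁ : ℂ) * u / (c₂ * conj u)) * _ * _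
  simp only [map_div₀, map_sub, map_mul]
  generalize conj (a₁ : ℂ) = b₁ at *
  generalize conj (a₂ : ℂ) = b₂ at *
  generalize conj (c₂ : ℂ) = d₂ at *
  generalize conj u = v at *
  generalize hD : 1 - b₂ * (z : ℂ) = D at *
  field_simp
  subst hD
  rw [hcu, hu]
  linear_combination ((a₁ : ℂ) * (1 - b₂ * (z : ℂ)) ^ 2
    + c₂ * ((z : ℂ) - a₂) * (1 - b₂ * (z : ℂ))) * hc

/-- The group of automorphisms (Möbius transformations) of the unit disc, under composition.  An
automorphism is represented by its extension to the closed disc. -/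
def DiscAut : Subgroup (Equiv.Perm 𝕔𝔻) where
  carrier := {g | IsMobius g}
  one_mem' := isMobius_one
  mul_mem' := IsMobius.mul
  inv_mem' := IsMobius.inv

theorem norm_apply_eq_one (g : DiscAut) (z : 𝕔𝔻) (hz : ‖(z : ℂ)‖ = 1) :
    ‖(g.1 z : ℂ)‖ = 1 := by
  obtain ⟨c, a, h⟩ := g.2
  have h0 := denom_ne_zero a z z.norm_le_one
  have e := normSq_mobius c a z
  have e1 : normSq (z : ℂ) = 1 := by rw [normSq_eq_norm_sq, hz, one_pow]
  rw [e1, sub_self, mul_zero, sub_eq_zero] at e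
  rw [h, norm_div, div_eq_one_iff_eq (norm_ne_zero_iff.mpr h0), Complex.norm_def,
    Complex.norm_def, e]

/-- The action of an automorphism on the unit circle. -/
def circleAct (g : DiscAut) (ζ : Circle) : Circle :=
  ⟨(g.1 (UnitClosedDisc.mk ζ (Circle.norm_coe ζ).le) : ℂ),
    mem_sphere_zero_iff_norm.mpr (norm_apply_eq_one g _ (Circle.norm_coe ζ))⟩

/-! ### Lebesgue and Hardy spaces

The unit circle is parametrized by `t ∈ ℝ / ℤ` through `t ↦ exp (2 π i t)`, and `m` is normalized
Lebesgue measure. -/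

/-- The homeomorphism `t ↦ exp (2 π i t)` of `ℝ / ℤ` onto the unit circle. -/
abbrev param : UnitAddCircle ≃ₜ Circle := AddCircle.homeomorphCircle one_ne_zero

/-- Normalized Lebesgue measure on the circle. -/
abbrev m : Measure UnitAddCircle := AddCircle.haarAddCircle

/-- The action of an automorphism on the circle, in the parameter `t`. -/
def bdry (g : DiscAut) (t : UnitAddCircle) : UnitAddCircle :=
  param.symm (circleAct g (param t))

/-- The Hardy space `H^p`: the `f ∈ L^p` whose Fourier coefficients of negative index vanish. -/
def Hardy (p : ℝ≥0∞) : Set (Lp ℂ p m) :=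
  {f | ∀ n : ℤ, n < 0 → fourierCoeff f n = 0}

/-- The fixed-point space `H^p_Γ`: the `f ∈ H^p` with `f ∘ γ = f` in `L^p` for all `γ ∈ Γ`. -/
def HardyFix (Γ : Subgroup DiscAut) (p : ℝ≥0∞) : Set (Lp ℂ p m) :=
  {f | f ∈ Hardy p ∧ ∀ γ ∈ Γ, (fun t => f (bdry γ t)) =ᵐ[m] f}

/-- `H^∞_Γ`, regarded as a subset of `L^p`. -/
def HardyFixInfty (Γ : Subgroup DiscAut) (p : ℝ≥0∞) : Set (Lp ℂ p m) :=
  {f | ∃ g ∈ HardyFix Γ ∞, f =ᵐ[m] g}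

/-- `[X]_p`, the smallest closed subspace of `L^p` that contains `X` (for `1 ≤ p < ∞`). -/
def closedSpan {p : ℝ≥0∞} [Fact (1 ≤ p)] (X : Set (Lp ℂ p m)) : Submodule ℂ (Lp ℂ p m) :=
  (Submodule.span ℂ X).topologicalClosure

/-! ### The conditional expectation, the defect space and admissible groups -/

/-- The `σ`-algebra of (Borel) measurable sets `E` that are `Γ`-invariant, that is,
`m (E ∆ γ⁻¹ E) = 0` for all `γ ∈ Γ`. -/
@[reducible] def invariantSigma (Γ : Subgroup DiscAut) : MeasurableSpace UnitAddCircle where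
  MeasurableSet' E := MeasurableSet E ∧ ∀ γ ∈ Γ, m (symmDiff E (bdry γ ⁻¹' E)) = 0
  measurableSet_empty := by simp
  measurableSet_compl := fun E hE => ⟨hE.1.compl, fun γ hγ => by
    rw [Set.preimage_compl, compl_symmDiff_compl]; exact hE.2 γ hγ⟩
  measurableSet_iUnion := fun E hE => ⟨MeasurableSet.iUnion fun i => (hE i).1, fun γ hγ => by
    refine measure_mono_null ?_ (measure_iUnion_null fun i => (hE i).2 γ hγ)
    rw [Set.preimage_iUnion]
    exact Set.iUnion_symmDiff_iUnion_subset⟩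

theorem invariantSigma_le (Γ : Subgroup DiscAut) :
    invariantSigma Γ ≤ (inferInstance : MeasurableSpace UnitAddCircle) :=
  fun _ hE => hE.1

/-- The conditional expectation `Ψ` onto the `Γ`-invariant functions. -/
def Psi (Γ : Subgroup DiscAut) (f : UnitAddCircle → ℂ) : UnitAddCircle → ℂ :=
  condExp (invariantSigma Γ) m f

/-- The Szegő kernel function `k_w (ζ) = 1 / (1 - conj w * ζ)` on the circle. -/
def szego (w : ℂ) (t : UnitAddCircle) : ℂ := 1 / (1 - conj w * (param t : ℂ))

/-- `v_γ = -i Ψ (k_{γ(0)} - conj k_{γ(0)})`, up to equality almost everywhere. -/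
def defectVec (Γ : Subgroup DiscAut) (γ : DiscAut) : UnitAddCircle →ₘ[m] ℂ :=
  AEEqFun.mk
    ((-I) • Psi Γ (fun t => szego (γ.1 0) t - conj (szego (γ.1 0) t)))
    ((stronglyMeasurable_condExp.mono (invariantSigma_le Γ)).const_smul (-I)).aestronglyMeasurable

/-- The defect space `N`, the linear span of the `v_γ` for `γ ∈ Γ`. -/
def defectSpace (Γ : Subgroup DiscAut) : Submodule ℂ (UnitAddCircle →ₘ[m] ℂ) :=
  Submodule.span ℂ {v | ∃ γ ∈ Γ, v = defectVec Γ γ}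

/-- `Γ` is of convergence type: `∑_{γ ∈ Γ} (1 - |γ(0)|) < ∞`.  Such a group is discrete, that is,
Fuchsian. -/
def IsConvergenceType (Γ : Subgroup DiscAut) : Prop :=
  Summable fun γ : Γ => 1 - ‖(γ.1.1 0 : ℂ)‖

/-- Admissible groups: of convergence type, with finite-dimensional defect space. -/
structure IsAdmissible (Γ : Subgroup DiscAut) : Prop where
  convergenceType : IsConvergenceType Γ
  finiteDimensional : FiniteDimensional ℂ (defectSpace Γ)

end HardyFixed

end

noncomputable section

namespace HardyFixed

open Filter Topology


/-! One inclusion is soft: `HardyFix Γ p` is closed, because Fourier coefficients and composition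
with an automorphism are continuous on L^p. For the other, f in H^p_Γ is multiplied by invariant
bounded analytic functions F_n, uniformly bounded, such that each F_n f is bounded and F_n → 1 a.e.
along a subsequence. Dominated convergence then gives F_n f → f in L^p along it.

The natural candidate for F_n is the outer function with log|F_n| = u_n = -log⁺(|f|/(n+1)), that is,
exp(A u_n) with A u = u + iũ (`analyticCompletion`). Although u_n is invariant, ũ_n need not be: for
real invariant u, the difference (A u)∘γ - A u is analytic and purely imaginary, hence constant, and
the constant is ∫ u (conj k - k) with k the Szegő kernel at γ(0). It vanishes exactly when u is
orthogonal to v_γ (`analyticCompletion_comp_bdry` uses the sufficiency).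

So u_n is replaced by w_n, the real part of its component orthogonal to N (`exists_correction`). As
N is finite-dimensional and consists of bounded functions, the sup norm of w_n - u_n is at most
K‖u_n‖₂, and ‖u_n‖₂ → 0 because (log⁺ x)² ≤ 4x. Thus exp(A w_n) keeps the decay needed to make the
product with f bounded, and tends to 1.

Bounded analytic functions enter through `IsMultiplier`: multiplication preserves vanishing of
negative coefficients and is multiplicative on means. The class is closed under sums, products and
bounded pointwise limits, hence contains the exponentials that occur. Multiplicativity of the mean
also yields the change of variables `map_bdry`, since the mean of g^n is g(0)^n. -/

/-! ### Fourier coefficients and bounded analytic multipliers. -/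

theorem norm_fourier_apply (n : ℤ) (t : UnitAddCircle) : ‖fourier n t‖ = 1 := Circle.norm_coe _

/-- Bounded functions `F` such that multiplication by `F` preserves analyticity, and is
multiplicative on mean values. -/
structure IsMultiplier (F : UnitAddCircle → ℂ) : Prop where
  aestronglyMeasurable : AEStronglyMeasurable F m
  bounded : ∃ C : ℝ, ∀ᵐ t ∂m, ‖F t‖ ≤ C
  coeff : ∀ f : UnitAddCircle → ℂ, Integrable f m → (∀ n < 0, fourierCoeff f n = 0) →
    ∀ n ≤ 0, fourierCoeff (fun t => F t * f t) n = fourierCoeff F 0 * fourierCoeff f n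

theorem fourierCoeff_zero (f : UnitAddCircle → ℂ) : fourierCoeff f 0 = ∫ t, f t ∂m := by
  simp [fourierCoeff]

theorem fourierCoeff_const (c : ℂ) (n : ℤ) :
    fourierCoeff (fun _ : UnitAddCircle => c) n = if n = 0 then c else 0 := by
  have h := congrFun (fourierCoeff_fourier (T := (1 : ℝ)) 0) n
  have h2 := fourierCoeff.const_mul (T := (1 : ℝ)) (fourier 0) c n
  rw [h] at h2
  simpa [Pi.single_apply] using h2

theorem fourierCoeff_add_apply {f g : UnitAddCircle → ℂ} (hf : Integrable f m)
    (hg : Integrable g m) (n : ℤ) :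
    fourierCoeff (fun t => f t + g t) n = fourierCoeff f n + fourierCoeff g n :=
  congrFun (fourierCoeff.add hf hg) n

theorem fourierCoeff_sub_apply {f g : UnitAddCircle → ℂ} (hf : Integrable f m)
    (hg : Integrable g m) (n : ℤ) :
    fourierCoeff (fun t => f t - g t) n = fourierCoeff f n - fourierCoeff g n := by
  have h := fourierCoeff_add_apply hf (hg.const_mul (-1)) n
  rw [fourierCoeff.const_mul] at h
  simpa [sub_eq_add_neg] using h

theorem fourierCoeff_conj (f : UnitAddCircle → ℂ) (n : ℤ) :
    fourierCoeff (fun t => conj (f t)) n = conj (fourierCoeff f (-n)) := by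
  rw [fourierCoeff, fourierCoeff, ← integral_conj]
  refine integral_congr_ae (ae_of_all _ fun t => ?_)
  simp only [smul_eq_mul, map_mul, ← fourier_neg, neg_neg]

theorem fourierCoeff_fourier_mul (f : UnitAddCircle → ℂ) (k n : ℤ) :
    fourierCoeff (fun t => fourier k t * f t) n = fourierCoeff f (n - k) := by
  rw [fourierCoeff, fourierCoeff]
  refine integral_congr_ae (ae_of_all _ fun t => ?_)
  simp only [smul_eq_mul]
  rw [← mul_assoc, ← fourier_add, neg_sub, sub_eq_neg_add]

theorem norm_fourierCoeff_sub_le {f g : UnitAddCircle → ℂ} (hf : Integrable f m)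
    (hg : Integrable g m) (n : ℤ) :
    ‖fourierCoeff f n - fourierCoeff g n‖ ≤ ∫ t, ‖f t - g t‖ ∂m := by
  rw [← fourierCoeff_sub_apply hf hg, fourierCoeff]
  refine (norm_integral_le_integral_norm _).trans_eq (integral_congr_ae (ae_of_all _ fun t => ?_))
  simp only [norm_smul, norm_fourier_apply, one_mul]

namespace IsMultiplier

variable {F G : UnitAddCircle → ℂ}

theorem mul_integrable (hF : IsMultiplier F) {f : UnitAddCircle → ℂ} (hf : Integrable f m) :
    Integrable (fun t => F t * f t) m := by
  obtain ⟨C, hC⟩ := hF.bounded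
  exact hf.bdd_mul hF.aestronglyMeasurable hC

theorem integrable (hF : IsMultiplier F) : Integrable F m := by
  simpa using hF.mul_integrable (integrable_const (1 : ℂ))

theorem memLp (hF : IsMultiplier F) (p : ℝ≥0∞) : MemLp F p m := by
  obtain ⟨C, hC⟩ := hF.bounded
  exact MemLp.of_bound hF.aestronglyMeasurable C hC

theorem coeff_neg (hF : IsMultiplier F) {n : ℤ} (hn : n < 0) : fourierCoeff F n = 0 := by
  have h := hF.coeff (fun _ => 1) (integrable_const _)
    (fun k hk => by simp [fourierCoeff_const, hk.ne]) n hn.le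
  simpa [fourierCoeff_const, hn.ne] using h

theorem mul_coeff_neg (hF : IsMultiplier F) {f : UnitAddCircle → ℂ} (hf : Integrable f m)
    (hf' : ∀ n < 0, fourierCoeff f n = 0) {n : ℤ} (hn : n < 0) :
    fourierCoeff (fun t => F t * f t) n = 0 := by
  rw [hF.coeff f hf hf' n hn.le, hf' n hn, mul_zero]

theorem congr_ae (hF : IsMultiplier F) (h : F =ᵐ[m] G) : IsMultiplier G where
  aestronglyMeasurable := hF.aestronglyMeasurable.congr h
  bounded := by
    obtain ⟨C, hC⟩ := hF.bounded
    exact ⟨C, by filter_upwards [hC, h] with t h1 h2; rwa [← h2]⟩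
  coeff f hf hf' n hn := by
    rw [← fourierCoeff_congr_ae h, ← hF.coeff f hf hf' n hn]
    refine congrFun (fourierCoeff_congr_ae ?_) n
    filter_upwards [h] with t ht
    rw [ht]

theorem const (c : ℂ) : IsMultiplier fun _ => c where
  aestronglyMeasurable := aestronglyMeasurable_const
  bounded := ⟨‖c‖, ae_of_all _ fun _ => le_rfl⟩
  coeff f _ _ n _ := by rw [fourierCoeff.const_mul, fourierCoeff_const, if_pos rfl]

theorem fourier_one : IsMultiplier (fourier 1) where
  aestronglyMeasurable := (map_continuous (fourier 1)).aestronglyMeasurable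
  bounded := ⟨1, ae_of_all _ fun _ => (norm_fourier_apply _ _).le⟩
  coeff f _ hf' n hn := by
    -- Both sides vanish: the shifted index `n - 1` is negative, and `fourier 1` has mean zero.
    rw [fourierCoeff_fourier_mul, hf' _ (by lia), fourierCoeff_fourier]
    simp

theorem mul (hF : IsMultiplier F) (hG : IsMultiplier G) : IsMultiplier fun t => F t * G t where
  aestronglyMeasurable := hF.aestronglyMeasurable.mul hG.aestronglyMeasurable
  bounded := by
    obtain ⟨C, hC⟩ := hF.bounded
    obtain ⟨D, hD⟩ := hG.bounded
    refine ⟨C * D, ?_⟩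
    filter_upwards [hC, hD] with t h1 h2
    rw [norm_mul]
    exact mul_le_mul h1 h2 (norm_nonneg _) ((norm_nonneg _).trans h1)
  coeff f hf hf' n hn := by
    have h1 := hF.coeff _ (hG.mul_integrable hf) (fun k hk => hG.mul_coeff_neg hf hf' hk) n hn
    rw [hF.coeff G hG.integrable (fun k hk => hG.coeff_neg hk) 0 le_rfl]
    simp only [mul_assoc, h1, hG.coeff f hf hf' n hn]

theorem coeff_zero_mul (hF : IsMultiplier F) (hG : IsMultiplier G) :
    fourierCoeff (fun t => F t * G t) 0 = fourierCoeff F 0 * fourierCoeff G 0 :=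
  hF.coeff G hG.integrable (fun _ hk => hG.coeff_neg hk) 0 le_rfl

theorem add (hF : IsMultiplier F) (hG : IsMultiplier G) : IsMultiplier fun t => F t + G t where
  aestronglyMeasurable := hF.aestronglyMeasurable.add hG.aestronglyMeasurable
  bounded := by
    obtain ⟨C, hC⟩ := hF.bounded
    obtain ⟨D, hD⟩ := hG.bounded
    refine ⟨C + D, ?_⟩
    filter_upwards [hC, hD] with t h1 h2
    exact (norm_add_le _ _).trans (add_le_add h1 h2)
  coeff f hf hf' n hn := by
    simp only [add_mul]
    rw [fourierCoeff_add_apply (hF.mul_integrable hf) (hG.mul_integrable hf),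
      fourierCoeff_add_apply hF.integrable hG.integrable, hF.coeff f hf hf' n hn,
      hG.coeff f hf hf' n hn, add_mul]

theorem const_mul (c : ℂ) (hF : IsMultiplier F) : IsMultiplier fun t => c * F t :=
  (const c).mul hF

theorem sub (hF : IsMultiplier F) (hG : IsMultiplier G) : IsMultiplier fun t => F t - G t := by
  simpa [sub_eq_add_neg] using hF.add (hG.const_mul (-1))

theorem pow (hF : IsMultiplier F) (k : ℕ) : IsMultiplier fun t => F t ^ k := by
  induction k with
  | zero => simpa using const 1
  | succ k ih => simpa only [pow_succ] using ih.mul hF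

theorem coeff_zero_pow (hF : IsMultiplier F) (k : ℕ) :
    fourierCoeff (fun t => F t ^ k) 0 = fourierCoeff F 0 ^ k := by
  induction k with
  | zero => simp [fourierCoeff_const]
  | succ k ih =>
    simp only [pow_succ]
    rw [(hF.pow k).coeff_zero_mul hF, ih]

theorem sum {ι : Type*} (s : Finset ι) {F : ι → UnitAddCircle → ℂ}
    (hF : ∀ i ∈ s, IsMultiplier (F i)) : IsMultiplier fun t => ∑ i ∈ s, F i t := by
  classical
  induction s using Finset.induction_on with
  | empty => simpa using const 0
  | insert a s ha ih =>
    simp only [Finset.sum_insert ha]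
    exact (hF a (Finset.mem_insert_self a s)).add
      (ih fun i hi => hF i (Finset.mem_insert_of_mem hi))

theorem fourier_nat (k : ℕ) : IsMultiplier (fourier (k : ℤ)) := by
  have h : (fourier (k : ℤ) : UnitAddCircle → ℂ) = fun t => fourier 1 t ^ k := by
    ext t
    induction k with
    | zero => simp
    | succ k ih => rw [pow_succ, ← ih, Nat.cast_succ, fourier_add]
  rw [h]
  exact fourier_one.pow k

/-- Dominated convergence passes to the limit in the coefficients of `F k * f` and in the means of
`F k`. Multipliers that are not polynomials in known ones are built this way. -/
theorem limit {F : ℕ → UnitAddCircle → ℂ} (hF : ∀ k, IsMultiplier (F k)) (C : ℝ)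
    (hC : ∀ k, ∀ᵐ t ∂m, ‖F k t‖ ≤ C)
    (hlim : ∀ᵐ t ∂m, Tendsto (fun k => F k t) atTop (𝓝 (G t))) : IsMultiplier G := by
  have hmeas : AEStronglyMeasurable G m :=
    aestronglyMeasurable_of_tendsto_ae atTop (fun k => (hF k).aestronglyMeasurable) hlim
  have key : ∀ f : UnitAddCircle → ℂ, Integrable f m → ∀ n,
      Tendsto (fun k => fourierCoeff (fun t => F k t * f t) n) atTop
        (𝓝 (fourierCoeff (fun t => G t * f t) n)) := by
    intro f hf n
    refine tendsto_integral_of_dominated_convergence (fun t => C * ‖f t‖) (fun k => ?_)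
      (hf.norm.const_mul C) (fun k => ?_) ?_
    · exact (((hF k).mul_integrable hf).fourier_smul _).aestronglyMeasurable
    · filter_upwards [hC k] with t ht
      rw [norm_smul, norm_fourier_apply, one_mul, norm_mul]
      gcongr
    · filter_upwards [hlim] with t ht
      exact (ht.mul_const _).const_smul _
  refine ⟨hmeas, ⟨C, ?_⟩, fun f hf hf' n hn => ?_⟩
  · filter_upwards [ae_all_iff.2 hC, hlim] with t h1 h2
    exact le_of_tendsto h2.norm (Eventually.of_forall h1)
  · have h0 : Tendsto (fun k => fourierCoeff (F k) 0) atTop (𝓝 (fourierCoeff G 0)) := by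
      simpa using key (fun _ => 1) (integrable_const _) 0
    refine tendsto_nhds_unique (key f hf n) ?_
    simpa only [(hF _).coeff f hf hf' n hn] using h0.mul_const _

/-- The partial sums of the exponential series are multipliers, uniformly bounded by `Real.exp C`
when `F` is bounded by `C`. -/
theorem exp (hF : IsMultiplier F) : IsMultiplier fun t => Complex.exp (F t) := by
  obtain ⟨C, hC⟩ := hF.bounded
  refine limit (F := fun k t => ∑ j ∈ Finset.range k, ((j.factorial : ℂ)⁻¹) * F t ^ j)
    (fun k => sum _ fun j _ => (hF.pow j).const_mul _) (Real.exp C) (fun k => ?_)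
    (ae_of_all _ fun t => ?_)
  · filter_upwards [hC] with t ht
    refine (norm_sum_le _ _).trans ((Finset.sum_le_sum fun j _ => ?_).trans
      (Real.sum_le_exp_of_nonneg ((norm_nonneg (F t)).trans ht) k))
    rw [norm_mul, norm_pow, norm_inv, Complex.norm_natCast, div_eq_inv_mul]
    gcongr
  · have := (NormedSpace.expSeries_div_hasSum_exp (F t)).tendsto_sum_nat
    rw [← Complex.exp_eq_exp_ℂ] at this
    simpa only [div_eq_inv_mul] using this

end IsMultiplier

/-! ### The Szegő kernel. -/

theorem param_eq_fourier_one (t : UnitAddCircle) : (param t : ℂ) = fourier 1 t := by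
  rw [fourier_one, AddCircle.homeomorphCircle_apply]

theorem szego_eq (w : ℂ) (t : UnitAddCircle) : szego w t = (1 - conj w * fourier 1 t)⁻¹ := by
  rw [szego, param_eq_fourier_one, one_div]

theorem norm_conj_mul_fourier (w : ℂ) (t : UnitAddCircle) : ‖conj w * fourier 1 t‖ = ‖w‖ := by
  rw [norm_mul, norm_fourier_apply, mul_one, norm_conj]

theorem one_sub_conj_mul_fourier_ne_zero {w : ℂ} (hw : ‖w‖ < 1) (t : UnitAddCircle) :
    1 - conj w * fourier 1 t ≠ 0 := by
  intro h
  have := norm_conj_mul_fourier w t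
  rw [← sub_eq_zero.1 h, norm_one] at this
  linarith

theorem norm_szego_le {w : ℂ} (hw : ‖w‖ < 1) (t : UnitAddCircle) :
    ‖szego w t‖ ≤ (1 - ‖w‖)⁻¹ := by
  rw [szego_eq, norm_inv]
  refine inv_anti₀ (by linarith) ?_
  have := norm_sub_norm_le (1 : ℂ) (conj w * fourier 1 t)
  rwa [norm_one, norm_conj_mul_fourier] at this

theorem continuous_szego {w : ℂ} (hw : ‖w‖ < 1) : Continuous (szego w) := by
  have : szego w = fun t => (1 - conj w * fourier 1 t)⁻¹ := funext (szego_eq w)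
  rw [this]
  exact (continuous_const.sub (continuous_const.mul (map_continuous (fourier 1)))).inv₀
    (one_sub_conj_mul_fourier_ne_zero hw)

theorem isMultiplier_szego {w : ℂ} (hw : ‖w‖ < 1) : IsMultiplier (szego w) := by
  refine IsMultiplier.limit
    (F := fun k t => ∑ j ∈ Finset.range k, (conj w * fourier 1 t) ^ j)
    (fun k => IsMultiplier.sum _ fun j _ => (IsMultiplier.fourier_one.const_mul _).pow j)
    (1 - ‖w‖)⁻¹ (fun k => ae_of_all _ fun t => ?_) (ae_of_all _ fun t => ?_)
  · refine (norm_sum_le _ _).trans ?_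
    simp only [norm_pow, norm_conj_mul_fourier]
    rw [← tsum_geometric_of_lt_one (norm_nonneg w) hw]
    exact (summable_geometric_of_lt_one (norm_nonneg w) hw).sum_le_tsum _
      fun _ _ => by positivity
  · rw [szego_eq]
    exact (hasSum_geometric_of_norm_lt_one
      ((norm_conj_mul_fourier w t).trans_lt hw)).tendsto_sum_nat

/-- The identity k = 1 + conj w · ζ · k turns into a recursion for the coefficients, started by
their vanishing at negative indices. -/
theorem fourierCoeff_szego {w : ℂ} (hw : ‖w‖ < 1) (n : ℕ) :
    fourierCoeff (szego w) n = conj w ^ n := by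
  have hk := isMultiplier_szego hw
  have step : ∀ n : ℤ, fourierCoeff (szego w) n =
      (if n = 0 then 1 else 0) + conj w * fourierCoeff (szego w) (n - 1) := by
    intro n
    rw [← fourierCoeff_const, ← fourierCoeff_fourier_mul, ← fourierCoeff.const_mul,
      ← fourierCoeff_add_apply (integrable_const _)
        ((IsMultiplier.fourier_one.mul hk).integrable.const_mul _)]
    congr 1
    ext t
    rw [szego_eq]
    linear_combination mul_inv_cancel₀ (one_sub_conj_mul_fourier_ne_zero hw t)
  induction n with
  | zero => simpa [hk.coeff_neg] using step 0
  | succ n ih =>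
    rw [step, if_neg (by lia), Nat.cast_succ, add_sub_cancel_right, ih]
    ring


/-! ### Boundary values of automorphisms. -/

theorem norm_apply_zero_lt_one (g : DiscAut) : ‖(g.1 0 : ℂ)‖ < 1 := by
  obtain ⟨c, a, h⟩ := g.2
  simpa [h, Circle.norm_coe] using a.norm_lt_one

/-- The boundary values of an automorphism are a bounded analytic function with mean `g 0`. -/
theorem isMultiplier_param_bdry (g : DiscAut) :
    IsMultiplier (fun t => (param (bdry g t) : ℂ)) ∧
      fourierCoeff (fun t => (param (bdry g t) : ℂ)) 0 = g.1 0 := by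
  obtain ⟨c, a, h⟩ := g.2
  have hform : (fun t => (param (bdry g t) : ℂ)) =
      fun t => ((c : ℂ) * (a - fourier 1 t)) * szego a t := by
    ext t
    rw [bdry, Homeomorph.apply_symm_apply, szego, ← param_eq_fourier_one, mul_one_div]
    exact h _
  have ha := a.norm_lt_one
  have h1 : IsMultiplier fun t : UnitAddCircle => (c : ℂ) * (a - fourier 1 t) :=
    ((IsMultiplier.const _).sub IsMultiplier.fourier_one).const_mul _
  have hk := isMultiplier_szego ha
  have hc : fourierCoeff (fun t : UnitAddCircle => (c : ℂ) * (a - fourier 1 t)) 0 = c * a := by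
    rw [fourierCoeff.const_mul,
      fourierCoeff_sub_apply (integrable_const _) IsMultiplier.fourier_one.integrable,
      fourierCoeff_const, fourierCoeff_fourier]
    simp
  rw [hform]
  refine ⟨h1.mul hk, ?_⟩
  have hk0 := fourierCoeff_szego ha 0
  rw [Nat.cast_zero, pow_zero] at hk0
  rw [h1.coeff_zero_mul hk, hc, hk0, h]
  simp

theorem continuous_bdry (g : DiscAut) : Continuous (bdry g) := by
  obtain ⟨c, a, h⟩ := g.2
  refine param.symm.continuous.comp (Continuous.subtype_mk ?_ _)
  have : (fun t => (g.1 (UnitClosedDisc.mk (param t) (Circle.norm_coe (param t)).le) : ℂ)) =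
      fun t => ((c : ℂ) * (a - fourier 1 t)) * szego a t := by
    ext t
    rw [szego, ← param_eq_fourier_one, mul_one_div]
    exact h _
  rw [this]
  exact (continuous_const.mul (continuous_const.sub (map_continuous (fourier 1)))).mul
    (continuous_szego a.norm_lt_one)

theorem fourier_bdry (g : DiscAut) (n : ℕ) (t : UnitAddCircle) :
    fourier n (bdry g t) = (param (bdry g t) : ℂ) ^ n := by
  rw [param_eq_fourier_one]
  induction n with
  | zero => simp
  | succ k ih => rw [pow_succ, ← ih, Nat.cast_succ, fourier_add]

theorem isMultiplier_fourier_bdry (g : DiscAut) (n : ℕ) :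
    IsMultiplier fun t => fourier n (bdry g t) := by
  simpa only [fourier_bdry] using (isMultiplier_param_bdry g).1.pow n

/-! ### The Poisson kernel and the change of variables on the circle. -/

/-- The Poisson kernel on the circle. -/
def poisson (w : ℂ) (t : UnitAddCircle) : ℝ := 2 * (szego w t).re - 1

theorem ofReal_poisson (w : ℂ) (t : UnitAddCircle) :
    (poisson w t : ℂ) = szego w t + conj (szego w t) - 1 := by
  rw [add_conj, poisson]
  push_cast
  ring

theorem poisson_nonneg {w : ℂ} (hw : ‖w‖ < 1) (t : UnitAddCircle) : 0 ≤ poisson w t := by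
  have h0 := one_sub_conj_mul_fourier_ne_zero hw t
  have hn := norm_conj_mul_fourier w t
  rw [poisson, szego_eq, inv_re]
  generalize conj w * fourier 1 t = s at *
  have hs : normSq s < 1 := by
    rw [normSq_eq_norm_sq, hn]
    exact pow_lt_one₀ (norm_nonneg w) hw two_ne_zero
  have hpos : 0 < normSq (1 - s) := normSq_pos.2 h0
  -- With s = conj w · ζ the claim is |1 - s|² ≤ 2 Re (1 - s), which amounts to |s| ≤ 1.
  rw [sub_nonneg, ← mul_div_assoc, le_div_iff₀ hpos]
  simp only [normSq_apply, sub_re, sub_im, one_re, one_im] at hs ⊢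
  linarith

theorem poisson_le {w : ℂ} (hw : ‖w‖ < 1) (t : UnitAddCircle) :
    poisson w t ≤ 2 * (1 - ‖w‖)⁻¹ := by
  have := (re_le_norm _).trans (norm_szego_le hw t)
  rw [poisson]
  linarith

theorem continuous_poisson {w : ℂ} (hw : ‖w‖ < 1) : Continuous (poisson w) :=
  (continuous_const.mul (continuous_re.comp (continuous_szego hw))).sub continuous_const

/-- Split the Poisson kernel as k + conj k - 1. The terms k and 1 contribute the same value and
cancel; the term conj k picks out the conjugate of the n-th coefficient of k. -/
theorem integral_fourier_mul_poisson {w : ℂ} (hw : ‖w‖ < 1) (n : ℕ) :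
    ∫ t, fourier n t * (poisson w t : ℂ) ∂m = w ^ n := by
  have hk := isMultiplier_szego hw
  have hn := IsMultiplier.fourier_nat n
  have h1 : ∫ t, fourier n t * szego w t ∂m = if n = 0 then 1 else 0 := by
    have h2 : fourierCoeff (szego w) 0 = 1 := by simpa using fourierCoeff_szego hw 0
    rw [← fourierCoeff_zero, hn.coeff_zero_mul hk, fourierCoeff_fourier, h2, Pi.single_apply]
    simp [eq_comm]
  have h2 : ∫ t, fourier n t * conj (szego w t) ∂m = w ^ n := by
    have := fourierCoeff_szego hw n
    rw [fourierCoeff] at this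
    rw [← conj_conj (w ^ n), map_pow, ← this, ← integral_conj]
    refine integral_congr_ae (ae_of_all _ fun t => ?_)
    simp only [smul_eq_mul, map_mul, fourier_neg, conj_conj]
  have h3 : ∫ t, fourier (n : ℤ) t ∂m = if n = 0 then 1 else 0 := by
    rw [← fourierCoeff_zero, fourierCoeff_fourier, Pi.single_apply]
    simp [eq_comm]
  have hi : Integrable (fun t => fourier (n : ℤ) t * conj (szego w t)) m :=
    ((map_continuous (fourier (n : ℤ))).mul
      (continuous_conj.comp (continuous_szego hw))).integrable_of_hasCompactSupport
        (HasCompactSupport.of_compactSpace _)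
  calc ∫ t, fourier n t * (poisson w t : ℂ) ∂m
      = ∫ t, (fourier n t * szego w t + fourier n t * conj (szego w t)) - fourier n t ∂m := by
        simp only [ofReal_poisson]
        congr 1
        ext t
        ring
    _ = w ^ n := by
        rw [integral_sub (f := fun t => fourier n t * szego w t + fourier n t * conj (szego w t))
          ((hn.mul hk).integrable.add hi) hn.integrable, integral_add (hn.mul hk).integrable hi, h1, h2, h3]
        ring

theorem integrable_of_continuous {f : UnitAddCircle → ℂ} (hf : Continuous f) : Integrable f m :=
  hf.integrable_of_hasCompactSupport (HasCompactSupport.of_compactSpace _)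

/-- For n ≥ 0 both sides equal g(0)^n, the left one because the mean is multiplicative on
multipliers. Negative indices follow by conjugation, the Poisson kernel being real. -/
theorem integral_fourier_bdry (g : DiscAut) (n : ℤ) :
    ∫ t, fourier n (bdry g t) ∂m = ∫ t, fourier n t * (poisson (g.1 0) t : ℂ) ∂m := by
  have key : ∀ n : ℕ, ∫ t, fourier n (bdry g t) ∂m
      = ∫ t, fourier n t * (poisson (g.1 0) t : ℂ) ∂m := by
    intro n
    obtain ⟨h1, h2⟩ := isMultiplier_param_bdry g
    rw [integral_fourier_mul_poisson (norm_apply_zero_lt_one g), ← h2, ← h1.coeff_zero_pow,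
      fourierCoeff_zero]
    simp only [fourier_bdry]
  obtain ⟨k, rfl | rfl⟩ := n.eq_nat_or_neg
  · exact key k
  · simp only [fourier_neg]
    rw [integral_conj, key, ← integral_conj]
    simp

theorem continuous_integral_continuousMap :
    Continuous fun f : C(UnitAddCircle, ℂ) => ∫ t, f t ∂m := by
  have h : (fun f : C(UnitAddCircle, ℂ) => ∫ t, f t ∂m) =
      fun f => ∫ t, ContinuousMap.toLp (E := ℂ) 1 m ℂ f t ∂m :=
    funext fun f => integral_congr_ae (ContinuousMap.coeFn_toLp m f).symm
  rw [h]
  exact continuous_integral.comp (ContinuousMap.toLp (E := ℂ) 1 m ℂ).continuous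

/-- Both sides are linear and sup-norm continuous in `f`, so agreement on the exponentials suffices.
-/
theorem integral_continuousMap_bdry (g : DiscAut) (f : C(UnitAddCircle, ℂ)) :
    ∫ t, f (bdry g t) ∂m = ∫ t, f t * (poisson (g.1 0) t : ℂ) ∂m := by
  have hP := continuous_poisson (norm_apply_zero_lt_one g)
  have hf : f ∈ (Submodule.span ℂ (Set.range (fourier (T := (1 : ℝ))))).topologicalClosure := by
    rw [span_fourier_closure_eq_top]
    trivial
  have hint1 : ∀ f : C(UnitAddCircle, ℂ), Integrable (fun t => f (bdry g t)) m := fun f =>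
    integrable_of_continuous (f.continuous.comp (continuous_bdry g))
  have hint2 : ∀ f : C(UnitAddCircle, ℂ), Integrable (fun t => f t * (poisson (g.1 0) t : ℂ)) m :=
    fun f => integrable_of_continuous (f.continuous.mul (continuous_ofReal.comp hP))
  refine closure_minimal (t := {f : C(UnitAddCircle, ℂ) | ∫ t, f (bdry g t) ∂m =
    ∫ t, f t * (poisson (g.1 0) t : ℂ) ∂m}) ?_ ?_ hf
  · intro f hf
    induction hf using Submodule.span_induction with
    | mem x hx =>
      obtain ⟨n, rfl⟩ := hx
      exact integral_fourier_bdry g n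
    | zero => simp
    | add x y _ _ hx hy =>
      simp only [Set.mem_ofPred_eq, ContinuousMap.add_apply, add_mul] at *
      rw [integral_add (hint1 x) (hint1 y), integral_add (hint2 x) (hint2 y), hx, hy]
    | smul c x _ hx =>
      simp only [Set.mem_ofPred_eq, ContinuousMap.smul_apply, smul_eq_mul, mul_assoc,
        integral_const_mul] at *
      rw [hx]
  · exact isClosed_eq
      (continuous_integral_continuousMap.comp
        (ContinuousMap.continuous_precomp ⟨bdry g, continuous_bdry g⟩))
      (continuous_integral_continuousMap.comp
        (continuous_id.mul (continuous_const (y :=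
          (⟨fun t => (poisson (g.1 0) t : ℂ), continuous_ofReal.comp hP⟩ : C(UnitAddCircle, ℂ))))))

/-- Normalized Lebesgue measure is transported to a Poisson measure. -/
theorem map_bdry (g : DiscAut) :
    m.map (bdry g) = m.withDensity fun t => ENNReal.ofReal (poisson (g.1 0) t) := by
  have hw := norm_apply_zero_lt_one g
  have hP := continuous_poisson hw
  have hb : ∀ t, ENNReal.ofReal (poisson (g.1 0) t) ≤ ENNReal.ofReal (2 * (1 - ‖(g.1 0 : ℂ)‖)⁻¹) :=
    fun t => ENNReal.ofReal_le_ofReal (poisson_le hw t)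
  have hfin : IsFiniteMeasure (m.withDensity fun t => ENNReal.ofReal (poisson (g.1 0) t)) := by
    refine isFiniteMeasure_withDensity ?_
    exact ((lintegral_mono hb).trans_lt (by
      rw [lintegral_const, measure_univ, mul_one]
      exact ENNReal.ofReal_lt_top)).ne
  have hfin' : IsFiniteMeasure (m.map (bdry g)) := inferInstance
  refine ext_of_forall_integral_eq_of_IsFiniteMeasure fun f => ?_
  rw [integral_map (continuous_bdry g).aemeasurable f.continuous.aestronglyMeasurable,
    integral_withDensity_eq_integral_toReal_smul (hP.measurable.ennreal_ofReal)
      (ae_of_all _ fun _ => ENNReal.ofReal_lt_top)]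
  have h := integral_continuousMap_bdry g ⟨fun t => (f t : ℂ), continuous_ofReal.comp f.continuous⟩
  simp only [ContinuousMap.coe_mk, ← ofReal_mul] at h
  rw [integral_complex_ofReal, integral_complex_ofReal] at h
  rw [ofReal_inj.1 h]
  congr 1
  ext t
  rw [ENNReal.toReal_ofReal (poisson_nonneg hw t), smul_eq_mul, mul_comm]

/-- The Poisson kernel is bounded, so composition with `bdry g` is bounded on every L^p. -/
theorem map_bdry_le (g : DiscAut) :
    m.map (bdry g) ≤ ENNReal.ofReal (2 * (1 - ‖(g.1 0 : ℂ)‖)⁻¹) • m := by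
  rw [map_bdry, ← withDensity_const]
  exact withDensity_mono (ae_of_all _ fun t =>
    ENNReal.ofReal_le_ofReal (poisson_le (norm_apply_zero_lt_one g) t))

theorem quasiMeasurePreserving_bdry (g : DiscAut) :
    Measure.QuasiMeasurePreserving (bdry g) m m :=
  ⟨(continuous_bdry g).measurable, by rw [map_bdry]; exact withDensity_absolutelyContinuous _ _⟩

theorem memLp_comp_bdry (g : DiscAut) {p : ℝ≥0∞} {f : UnitAddCircle → ℂ} (hf : MemLp f p m) :
    MemLp (fun t => f (bdry g t)) p m :=
  (hf.of_measure_le_smul ENNReal.ofReal_ne_top (map_bdry_le g)).comp_of_map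
    (continuous_bdry g).aemeasurable

theorem eLpNorm_comp_bdry_le (g : DiscAut) (p : ℝ≥0∞) : ∃ K : ℝ≥0∞, K ≠ ∞ ∧
    ∀ f : UnitAddCircle → ℂ, AEStronglyMeasurable f m →
      eLpNorm (fun t => f (bdry g t)) p m ≤ K * eLpNorm f p m := by
  -- At p = ∞ the exponent is 0, so the constant is 1.
  refine ⟨ENNReal.ofReal (2 * (1 - ‖(g.1 0 : ℂ)‖)⁻¹) ^ (1 / p).toReal, ?_, fun f hf => ?_⟩
  · exact ENNReal.rpow_ne_top_of_nonneg ENNReal.toReal_nonneg ENNReal.ofReal_ne_top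
  · have h := eLpNorm_map_measure (p := p) (μ := m) (f := bdry g) (g := f)
      (hf.mono_ac (quasiMeasurePreserving_bdry g).absolutelyContinuous)
      (continuous_bdry g).aemeasurable
    exact h.symm.trans_le (eLpNorm_le_of_measure_le_smul (map_bdry_le g))

theorem integral_comp_bdry (g : DiscAut) {f : UnitAddCircle → ℂ}
    (hf : AEStronglyMeasurable f m) :
    ∫ t, f (bdry g t) ∂m = ∫ t, f t * (poisson (g.1 0) t : ℂ) ∂m := by
  have hw := norm_apply_zero_lt_one g
  rw [← integral_map (continuous_bdry g).aemeasurable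
    (hf.mono_ac (quasiMeasurePreserving_bdry g).absolutelyContinuous), map_bdry,
    integral_withDensity_eq_integral_toReal_smul
      ((continuous_poisson hw).measurable.ennreal_ofReal)
      (ae_of_all _ fun _ => ENNReal.ofReal_lt_top)]
  congr 1
  ext t
  rw [ENNReal.toReal_ofReal (poisson_nonneg hw t), real_smul, mul_comm]


/-! ### Continuity of coefficients and of composition on L^p. -/

section Continuity

variable (p : ℝ≥0∞) [hp : Fact (1 ≤ p)]

theorem integrable_coeFn {p : ℝ≥0∞} [hp : Fact (1 ≤ p)] (f : Lp ℂ p m) : Integrable f m :=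
  (Lp.memLp f).integrable hp.out

theorem continuous_fourierCoeff (n : ℤ) :
    Continuous fun f : Lp ℂ p m => fourierCoeff f n := by
  refine (LipschitzWith.of_dist_le_mul (K := 1) fun f g => ?_).continuous
  rw [dist_eq_norm, dist_eq_norm, NNReal.coe_one, one_mul]
  refine (norm_fourierCoeff_sub_le (integrable_coeFn f) (integrable_coeFn g) n).trans ?_
  have h : ∫ t, ‖f t - g t‖ ∂m = ∫ t, ‖(f - g : Lp ℂ p m) t‖ ∂m := by
    refine integral_congr_ae ?_
    filter_upwards [Lp.coeFn_sub f g] with t ht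
    rw [ht, Pi.sub_apply]
  rw [h, integral_norm_eq_lintegral_enorm (Lp.aestronglyMeasurable _), ← eLpNorm_one_eq_lintegral_enorm,
    Lp.norm_def]
  exact ENNReal.toReal_mono (Lp.eLpNorm_ne_top _)
    (eLpNorm_le_eLpNorm_of_exponent_le hp.out (Lp.aestronglyMeasurable _))

/-- Composition with an automorphism, as an operator on `L^p`. -/
def compL (g : DiscAut) : Lp ℂ p m →L[ℂ] Lp ℂ p m :=
  LinearMap.mkContinuousOfExistsBound
    { toFun := fun f => (memLp_comp_bdry g (Lp.memLp f)).toLp _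
      map_add' := fun f f' => by
        rw [← MemLp.toLp_add, MemLp.toLp_eq_toLp_iff]
        filter_upwards [(quasiMeasurePreserving_bdry g).ae_eq_comp (Lp.coeFn_add f f')] with t ht
        exact ht
      map_smul' := fun c f => by
        rw [RingHom.id_apply, ← MemLp.toLp_const_smul, MemLp.toLp_eq_toLp_iff]
        filter_upwards [(quasiMeasurePreserving_bdry g).ae_eq_comp (Lp.coeFn_smul c f)] with t ht
        exact ht }
    (by
      obtain ⟨K, hK, h⟩ := eLpNorm_comp_bdry_le g p
      refine ⟨K.toReal, fun f => ?_⟩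
      rw [LinearMap.coe_mk, AddHom.coe_mk, Lp.norm_toLp, Lp.norm_def, ← ENNReal.toReal_mul]
      exact ENNReal.toReal_mono (ENNReal.mul_ne_top hK (Lp.eLpNorm_ne_top f))
        (h f (Lp.aestronglyMeasurable f)))

theorem coeFn_compL (g : DiscAut) (f : Lp ℂ p m) :
    compL p g f =ᵐ[m] fun t => f (bdry g t) :=
  MemLp.coeFn_toLp (memLp_comp_bdry g (Lp.memLp f))

theorem compL_eq_self_iff (g : DiscAut) (f : Lp ℂ p m) :
    compL p g f = f ↔ (fun t => f (bdry g t)) =ᵐ[m] f := by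
  rw [Lp.ext_iff]
  exact ⟨(coeFn_compL p g f).symm.trans, (coeFn_compL p g f).trans⟩

end Continuity

/-! ### The space H² and the analytic completion of a real function. -/

theorem inner_fourierLp (f : Lp ℂ 2 m) (n : ℤ) :
    inner ℂ (fourierLp 2 n) f = fourierCoeff f n := by
  rw [← fourierBasis_repr, HilbertBasis.repr_apply_apply, coe_fourierBasis]

theorem eq_of_fourierCoeff_eq {f g : Lp ℂ 2 m} (h : ∀ n, fourierCoeff f n = fourierCoeff g n) :
    f = g := by
  refine (fourierBasis (T := (1 : ℝ))).repr.injective (lp.ext (funext fun n => ?_))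
  rw [fourierBasis_repr, fourierBasis_repr, h]

theorem ae_eq_zero_of_fourierCoeff_eq_zero {f : UnitAddCircle → ℂ} (hf : MemLp f 2 m)
    (h : ∀ n, fourierCoeff f n = 0) : f =ᵐ[m] 0 := by
  have h0 : hf.toLp f = 0 := eq_of_fourierCoeff_eq fun n => by
    rw [fourierCoeff_congr_ae hf.coeFn_toLp, h, fourierCoeff_congr_ae (Lp.coeFn_zero ℂ 2 m)]
    simp [fourierCoeff]
  exact hf.coeFn_toLp.symm.trans ((Lp.ext_iff.1 h0).trans (Lp.coeFn_zero ℂ 2 m))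

/-- The space `H²` as the orthogonal complement of the exponentials of negative index. -/
def hardyTwo : Submodule ℂ (Lp ℂ 2 m) :=
  (Submodule.span ℂ {f | ∃ n : ℤ, n < 0 ∧ f = fourierLp 2 n})ᗮ

theorem mem_hardyTwo {f : Lp ℂ 2 m} : f ∈ hardyTwo ↔ ∀ n < 0, fourierCoeff f n = 0 := by
  rw [hardyTwo, Submodule.mem_orthogonal]
  constructor
  · intro h n hn
    rw [← inner_fourierLp]
    exact h _ (Submodule.subset_span ⟨n, hn, rfl⟩)
  · intro h x hx
    induction hx using Submodule.span_induction with
    | mem x hx =>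
      obtain ⟨n, hn, rfl⟩ := hx
      rw [inner_fourierLp, h n hn]
    | zero => simp
    | add x y _ _ hx hy => rw [inner_add_left, hx, hy, add_zero]
    | smul c x _ hx => rw [inner_smul_left, hx, mul_zero]

instance : hardyTwo.HasOrthogonalProjection := by
  unfold hardyTwo
  infer_instance

theorem fourierCoeff_fourierLp (k n : ℤ) :
    fourierCoeff (fourierLp 2 k : Lp ℂ 2 m) n = if n = k then 1 else 0 := by
  rw [fourierCoeff_congr_ae (coeFn_fourierLp 2 k), fourierCoeff_fourier, Pi.single_apply]

theorem fourierLp_mem_hardyTwo {k : ℤ} (hk : 0 ≤ k) : (fourierLp 2 k : Lp ℂ 2 m) ∈ hardyTwo :=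
  mem_hardyTwo.2 fun n hn => by rw [fourierCoeff_fourierLp, if_neg (by lia)]

/-- The operator that takes a real function `u` to the analytic function `u + i ũ`, with `ũ` the
conjugate function. -/
def analyticCompletion : Lp ℂ 2 m →L[ℂ] Lp ℂ 2 m :=
  (2 : ℂ) • hardyTwo.starProjection -
    (innerSL ℂ (fourierLp 2 0 : Lp ℂ 2 m)).smulRight (fourierLp 2 0 : Lp ℂ 2 m)

theorem analyticCompletion_apply (u : Lp ℂ 2 m) : analyticCompletion u =
    (2 : ℂ) • hardyTwo.starProjection u - fourierCoeff u 0 • (fourierLp 2 0 : Lp ℂ 2 m) := by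
  rw [← inner_fourierLp]
  rfl

theorem fourierCoeff_analyticCompletion (u : Lp ℂ 2 m) (n : ℤ) :
    fourierCoeff (analyticCompletion u) n =
      if n < 0 then 0 else if n = 0 then fourierCoeff u 0 else 2 * fourierCoeff u n := by
  rw [← inner_fourierLp, analyticCompletion_apply, inner_sub_right, inner_smul_right,
    inner_smul_right, inner_fourierLp, inner_fourierLp, fourierCoeff_fourierLp]
  -- The projection is self-adjoint and fixes the exponentials of nonnegative index.
  have hP : 0 ≤ n → fourierCoeff (hardyTwo.starProjection u) n = fourierCoeff u n := by
    intro hn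
    rw [← inner_fourierLp, ← Submodule.inner_starProjection_left_eq_right,
      Submodule.starProjection_eq_self_iff.2 (fourierLp_mem_hardyTwo hn), inner_fourierLp]
  rcases lt_trichotomy n 0 with h | rfl | h
  · rw [mem_hardyTwo.1 (Submodule.starProjection_apply_mem hardyTwo u) n h, if_neg h.ne, if_pos h]
    simp
  · rw [hP le_rfl]
    simp only [lt_irrefl, if_true, if_false]
    ring
  · rw [hP h.le, if_neg h.ne', if_neg h.not_gt, if_neg h.ne']
    ring

theorem analyticCompletion_fourierLp (k : ℤ) : ∃ c : ℂ, (k < 0 → c = 0) ∧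
    analyticCompletion (fourierLp 2 k) = c • (fourierLp 2 k : Lp ℂ 2 m) := by
  refine ⟨if k < 0 then 0 else if k = 0 then 1 else 2, fun h => if_pos h, ?_⟩
  refine eq_of_fourierCoeff_eq fun n => ?_
  rw [fourierCoeff_analyticCompletion, ← inner_fourierLp (_ • _), inner_smul_right, inner_fourierLp,
    fourierCoeff_fourierLp, fourierCoeff_fourierLp]
  split_ifs <;> lia

/-- The completion of a trigonometric polynomial is again one, with nonnegative frequencies only.
For general u in L² the completion can be unbounded, so the outer functions below are limits from
this case. -/
theorem isMultiplier_analyticCompletion_toLp {q : C(UnitAddCircle, ℂ)}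
    (hq : q ∈ Submodule.span ℂ (Set.range (fourier (T := (1 : ℝ))))) :
    IsMultiplier (analyticCompletion (ContinuousMap.toLp (E := ℂ) 2 m ℂ q)) := by
  induction hq using Submodule.span_induction with
  | mem x hx =>
    obtain ⟨k, rfl⟩ := hx
    obtain ⟨c, hc, h⟩ := analyticCompletion_fourierLp k
    have h' : (analyticCompletion (fourierLp 2 k)) =ᵐ[m] fun t => c * fourier k t := by
      rw [h]
      filter_upwards [Lp.coeFn_smul c (fourierLp 2 k : Lp ℂ 2 m), coeFn_fourierLp 2 k]
        with t h1 h2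
      rw [h1, Pi.smul_apply, h2, smul_eq_mul]
    refine IsMultiplier.congr_ae ?_ h'.symm
    rcases lt_or_ge k 0 with hk | hk
    · simpa [hc hk] using IsMultiplier.const 0
    · lift k to ℕ using hk
      exact (IsMultiplier.fourier_nat k).const_mul c
  | zero =>
    rw [map_zero, map_zero]
    exact (IsMultiplier.const 0).congr_ae (Lp.coeFn_zero ℂ 2 m).symm
  | add x y _ _ hx hy =>
    rw [map_add, map_add]
    exact (hx.add hy).congr_ae (Lp.coeFn_add _ _).symm
  | smul c x _ hx =>
    rw [map_smul, map_smul]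
    exact (hx.const_mul c).congr_ae
      (Lp.coeFn_smul c (analyticCompletion (ContinuousMap.toLp (E := ℂ) 2 m ℂ x))).symm

/-- A real function has Hermitian coefficients, so twice its positive half plus the conjugate of
that half, with the mean adjusted, has the coefficients of `2 * u`. -/
theorem analyticCompletion_add_conj {u : Lp ℂ 2 m} (hu : ∀ᵐ t ∂m, conj (u t) = u t) :
    ∀ᵐ t ∂m, analyticCompletion u t + conj (analyticCompletion u t) = 2 * u t := by
  have hT := Lp.memLp (analyticCompletion u)
  have hTc : MemLp (fun t => conj (analyticCompletion u t)) 2 m := hT.star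
  have hu2 := (Lp.memLp u).const_mul (2 : ℂ)
  have huc : ∀ n, fourierCoeff u n = conj (fourierCoeff u (-n)) := fun n => by
    rw [← fourierCoeff_conj, fourierCoeff_congr_ae hu]
  have h := ae_eq_zero_of_fourierCoeff_eq_zero ((hT.add hTc).sub hu2) fun n => by
    have h1 := fourierCoeff_sub_apply ((hT.add hTc).integrable one_le_two)
      (hu2.integrable one_le_two) n
    have h2 := fourierCoeff_add_apply (hT.integrable one_le_two) (hTc.integrable one_le_two) n
    refine h1.trans ?_
    refine (congrArg (· - _) h2).trans ?_
    rw [fourierCoeff_conj, fourierCoeff.const_mul, fourierCoeff_analyticCompletion,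
      fourierCoeff_analyticCompletion]
    have h0 := huc 0
    have hn := huc n
    rw [neg_zero] at h0
    rcases lt_trichotomy n 0 with h | rfl | h
    · rw [if_pos h, if_neg (by lia), if_neg (by lia), hn, map_mul, map_ofNat]
      ring
    · simp only [lt_irrefl, if_true, if_false, neg_zero, ← h0]
      ring
    · rw [if_neg (by lia), if_neg (by lia), if_pos (by lia), map_zero]
      ring
  filter_upwards [h] with t ht
  exact sub_eq_zero.1 ht

theorem re_analyticCompletion {u : Lp ℂ 2 m} (hu : ∀ᵐ t ∂m, conj (u t) = u t) :
    ∀ᵐ t ∂m, (analyticCompletion u t).re = (u t).re := by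
  filter_upwards [analyticCompletion_add_conj hu] with t ht
  have := congrArg re ht
  simp at this
  linarith


/-- The coefficient is a continuous linear functional of `u`. On exponentials it vanishes, because
they are eigenvectors of the completion, with eigenvalue 0 at negative index, and the nonnegative
ones composed with `g` are multipliers. -/
theorem fourierCoeff_comp_analyticCompletion (g : DiscAut) (u : Lp ℂ 2 m) {n : ℤ} (hn : n < 0) :
    fourierCoeff (fun t => analyticCompletion u (bdry g t)) n = 0 := by
  have h : (innerSL ℂ (fourierLp 2 n : Lp ℂ 2 m)) ∘L compL 2 g ∘L analyticCompletion = 0 := by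
    refine ContinuousLinearMap.ext_on
      (s := Set.range (fourierLp (T := (1 : ℝ)) 2)) ?_ ?_
    · exact (Submodule.dense_iff_topologicalClosure_eq_top).2
        (span_fourierLp_closure_eq_top (by simp))
    · rintro _ ⟨k, rfl⟩
      obtain ⟨c, hc, h⟩ := analyticCompletion_fourierLp k
      change inner ℂ (fourierLp 2 n) (compL 2 g (analyticCompletion (fourierLp 2 k))) = 0
      rw [h, map_smul, inner_smul_right, inner_fourierLp, fourierCoeff_congr_ae ((coeFn_compL 2 g _).trans
        ((quasiMeasurePreserving_bdry g).ae_eq_comp (coeFn_fourierLp 2 k)))]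
      rcases lt_or_ge k 0 with hk | hk
      · rw [hc hk, zero_mul]
      · lift k to ℕ using hk
        exact mul_eq_zero_of_right _ ((isMultiplier_fourier_bdry g k).coeff_neg hn)
  have h2 := DFunLike.congr_fun h u
  change inner ℂ (fourierLp 2 n) (compL 2 g (analyticCompletion u)) = 0 at h2
  rwa [inner_fourierLp, fourierCoeff_congr_ae (coeFn_compL 2 g _)] at h2

/-! ### Bounded outer functions. -/

/-- A real trigonometric polynomial close to a given real function that is bounded above. -/
theorem exists_trigPoly {u : Lp ℂ 2 m} (hu : ∀ᵐ t ∂m, conj (u t) = u t) {C : ℝ}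
    (hC : ∀ᵐ t ∂m, (u t).re ≤ C) {ε : ℝ} (hε : 0 < ε) :
    ∃ q ∈ Submodule.span ℂ (Set.range (fourier (T := (1 : ℝ)))),
      (∀ t, conj (q t) = q t) ∧ (∀ t, (q t).re ≤ C + ε) ∧
      ‖ContinuousMap.toLp (E := ℂ) 2 m ℂ q - u‖ ≤ 2 * ε := by
  obtain ⟨f, hf⟩ := (ContinuousMap.toLp_denseRange ℂ m ℂ (p := 2) (by simp)).exists_dist_lt u hε
  -- Truncation at `C` is 1-Lipschitz and fixes `u`, so it enforces the upper bound without
  -- increasing the distance to `u`.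
  let v : C(UnitAddCircle, ℂ) := ⟨fun t => ((min (f t).re C : ℝ) : ℂ), by fun_prop⟩
  have hv : v ∈ (Submodule.span ℂ (Set.range (fourier (T := (1 : ℝ))))).topologicalClosure := by
    rw [span_fourier_closure_eq_top]
    trivial
  obtain ⟨q₀, hq₀, hd⟩ := Metric.mem_closure_iff.1 hv ε hε
  have hq₀' : q₀ ∈ fourierSubalgebra (T := (1 : ℝ)) := by
    rw [← fourierSubalgebra_coe] at hq₀
    exact hq₀
  -- The real part of `q₀`: still a trigonometric polynomial, and no further from the real function
  -- `v`.
  let q : C(UnitAddCircle, ℂ) := (2⁻¹ : ℂ) • (q₀ + star q₀)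
  have hq : q ∈ Submodule.span ℂ (Set.range (fourier (T := (1 : ℝ)))) := by
    rw [← fourierSubalgebra_coe]
    exact (fourierSubalgebra (T := (1 : ℝ))).smul_mem (add_mem hq₀' (star_mem hq₀')) _
  have hqt : ∀ t, q t = ((q₀ t).re : ℂ) := fun t => by
    change (2⁻¹ : ℂ) * (q₀ t + conj (q₀ t)) = _
    rw [add_conj]
    push_cast
    ring
  have hdist : ∀ t, ‖q t - v t‖ ≤ ε := fun t => by
    have h1 : ‖v t - q₀ t‖ < ε := by
      rw [← dist_eq_norm]
      exact (ContinuousMap.dist_apply_le_dist t).trans_lt hd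
    have h2 : q t - v t = (((q₀ t - v t).re : ℝ) : ℂ) := by
      rw [hqt, sub_re, ofReal_sub]
      rfl
    rw [h2, norm_real]
    refine (abs_re_le_norm _).trans ?_
    rw [norm_sub_rev]
    exact h1.le
  refine ⟨q, hq, fun t => by rw [hqt, conj_ofReal], fun t => ?_, ?_⟩
  · have h1 := (re_le_norm _).trans (hdist t)
    have h2 : (v t).re ≤ C := min_le_right _ _
    rw [sub_re] at h1
    linarith
  · have h1 : ‖ContinuousMap.toLp (E := ℂ) 2 m ℂ (q - v)‖ ≤ ε := by
      have := Lp.norm_le_of_ae_bound (f := ContinuousMap.toLp (E := ℂ) 2 m ℂ (q - v)) hε.le (by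
        filter_upwards [ContinuousMap.coeFn_toLp (𝕜 := ℂ) (p := 2) m (q - v)] with t ht
        rw [ht]
        exact hdist t)
      simpa [measureUnivNNReal] using this
    have h2 : ‖ContinuousMap.toLp (E := ℂ) 2 m ℂ v - u‖ ≤ ε := by
      refine (Lp.norm_le_norm_of_ae_le
        (g := ContinuousMap.toLp (E := ℂ) 2 m ℂ f - u) ?_).trans ?_
      · filter_upwards [hu, hC, Lp.coeFn_sub (ContinuousMap.toLp (E := ℂ) 2 m ℂ v) u,
          Lp.coeFn_sub (ContinuousMap.toLp (E := ℂ) 2 m ℂ f) u,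
          ContinuousMap.coeFn_toLp (𝕜 := ℂ) (p := 2) m v,
          ContinuousMap.coeFn_toLp (𝕜 := ℂ) (p := 2) m f] with t h1 h2 h3 h4 h5 h6
        rw [h3, h4, Pi.sub_apply, Pi.sub_apply, h5, h6]
        obtain ⟨r, hr⟩ := conj_eq_iff_real.1 h1
        rw [hr] at h2 ⊢
        rw [ofReal_re] at h2
        change ‖((min (f t).re C : ℝ) : ℂ) - r‖ ≤ _
        rw [← ofReal_sub, norm_real]
        have h7 := abs_re_le_norm (f t - r)
        rw [sub_re, ofReal_re] at h7
        refine le_trans ?_ h7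
        rw [Real.norm_eq_abs]
        have h8 := abs_min_sub_min_le_max (f t).re C r C
        rwa [min_eq_left h2, sub_self, abs_zero, max_eq_left (abs_nonneg _)] at h8
      · rw [← dist_eq_norm, dist_comm]
        exact hf.le
    rw [map_sub] at h1
    calc _ = ‖(ContinuousMap.toLp (E := ℂ) 2 m ℂ q - ContinuousMap.toLp (E := ℂ) 2 m ℂ v) +
          (ContinuousMap.toLp (E := ℂ) 2 m ℂ v - u)‖ := by rw [sub_add_sub_cancel]
      _ ≤ 2 * ε := (norm_add_le _ _).trans (by linarith)

theorem exists_subseq_ae {p : ℝ≥0∞} [Fact (1 ≤ p)] {F : ℕ → Lp ℂ p m} {G : Lp ℂ p m}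
    (h : Tendsto F atTop (𝓝 G)) : ∃ φ : ℕ → ℕ, StrictMono φ ∧
      ∀ᵐ t ∂m, Tendsto (fun k => F (φ k) t) atTop (𝓝 (G t)) :=
  (tendstoInMeasure_of_tendsto_Lp h).exists_seq_tendsto_ae

/-- The outer function with modulus `exp u`. -/
theorem isMultiplier_exp_analyticCompletion {u : Lp ℂ 2 m} (hu : ∀ᵐ t ∂m, conj (u t) = u t)
    {C : ℝ} (hC : ∀ᵐ t ∂m, (u t).re ≤ C) :
    IsMultiplier fun t => exp (analyticCompletion u t) := by
  choose q hq hqr hqC hqu using fun k : ℕ =>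
    exists_trigPoly hu hC (ε := 1 / (k + 1 : ℝ)) Nat.one_div_pos_of_nat
  have hlim : Tendsto (fun k => ContinuousMap.toLp (E := ℂ) 2 m ℂ (q k)) atTop (𝓝 u) := by
    rw [tendsto_iff_norm_sub_tendsto_zero]
    refine squeeze_zero (fun _ => norm_nonneg _) hqu ?_
    simpa using (tendsto_one_div_add_atTop_nhds_zero_nat (𝕜 := ℝ)).const_mul 2
  obtain ⟨φ, -, hφ⟩ := exists_subseq_ae ((analyticCompletion.continuous.tendsto u).comp hlim)
  -- The errors 1/(k+1) are at most 1, so all approximants have modulus at most exp(C + 1).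
  refine IsMultiplier.limit
    (F := fun k t => exp (analyticCompletion (ContinuousMap.toLp (E := ℂ) 2 m ℂ (q (φ k))) t))
    (fun k => (isMultiplier_analyticCompletion_toLp (hq (φ k))).exp) (Real.exp (C + 1))
    (fun k => ?_) ?_
  · have hcoe := ContinuousMap.coeFn_toLp (𝕜 := ℂ) (p := 2) m (q (φ k))
    have hre : ∀ᵐ t ∂m, conj (ContinuousMap.toLp (E := ℂ) 2 m ℂ (q (φ k)) t) =
        ContinuousMap.toLp (E := ℂ) 2 m ℂ (q (φ k)) t := by
      filter_upwards [hcoe] with t ht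
      rw [ht, hqr]
    filter_upwards [hcoe, re_analyticCompletion hre] with t h1 h2
    rw [norm_exp, h2, h1]
    refine Real.exp_le_exp.2 ((hqC (φ k) t).trans ?_)
    have : 1 / ((φ k : ℝ) + 1) ≤ 1 := by
      rw [div_le_one (by positivity)]
      linarith [(Nat.cast_nonneg (φ k) : (0 : ℝ) ≤ φ k)]
    linarith
  · filter_upwards [hφ] with t ht
    exact (continuous_exp.tendsto _).comp ht

/-! ### Invariance of the analytic completion. -/

/-- Change variables and write the Poisson kernel as k + conj k - 1. The analytic product k · A u
has mean û(0), which is real; the term with conj k is reduced to it by A u = 2u - conj (A u). -/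
theorem fourierCoeff_zero_comp_analyticCompletion {u : Lp ℂ 2 m} (hu : ∀ᵐ t ∂m, conj (u t) = u t) (g : DiscAut) :
    fourierCoeff (fun t => analyticCompletion u (bdry g t)) 0 =
      2 * ∫ t, u t * conj (szego (g.1 0) t) ∂m - fourierCoeff u 0 := by
  have hw := norm_apply_zero_lt_one g
  have hk := isMultiplier_szego hw
  have hTi := integrable_coeFn (analyticCompletion u)
  have hui := integrable_coeFn u
  have hbc : ∀ f : UnitAddCircle → ℂ, Integrable f m →
      Integrable (fun t => f t * conj (szego (g.1 0) t)) m := fun f hf =>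
    hf.mul_bdd (c := (1 - ‖(g.1 0 : ℂ)‖)⁻¹)
      (continuous_conj.comp (continuous_szego hw)).aestronglyMeasurable
      (ae_of_all _ fun t => by rw [norm_conj]; exact norm_szego_le hw t)
  have hT0 : fourierCoeff (analyticCompletion u) 0 = fourierCoeff u 0 := by
    rw [fourierCoeff_analyticCompletion, if_neg (lt_irrefl _), if_pos rfl]
  have hu0 : conj (fourierCoeff u 0) = fourierCoeff u 0 := by
    have := fourierCoeff_conj u 0
    rw [fourierCoeff_congr_ae hu, neg_zero] at this
    exact this.symm
  have h1 : ∫ t, szego (g.1 0) t * analyticCompletion u t ∂m = fourierCoeff u 0 := by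
    have hk0 := fourierCoeff_szego hw 0
    rw [Nat.cast_zero, pow_zero] at hk0
    rw [← fourierCoeff_zero, hk.coeff _ hTi (fun n hn => by
      rw [fourierCoeff_analyticCompletion, if_pos hn]) 0 le_rfl, hk0, one_mul, hT0]
  have h2 : ∫ t, analyticCompletion u t * conj (szego (g.1 0) t) ∂m =
      2 * ∫ t, u t * conj (szego (g.1 0) t) ∂m - fourierCoeff u 0 := by
    rw [← hu0, ← h1, ← integral_conj, ← integral_const_mul, ← integral_sub]
    · refine integral_congr_ae ?_
      filter_upwards [analyticCompletion_add_conj hu] with t ht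
      rw [map_mul, ← mul_assoc, ← ht]
      ring
    · exact (hbc u hui).const_mul 2
    · exact (memLp_one_iff_integrable.2 (hk.mul_integrable hTi)).star.integrable le_rfl
  rw [fourierCoeff_zero, integral_comp_bdry g (Lp.aestronglyMeasurable _)]
  calc ∫ t, analyticCompletion u t * (poisson (g.1 0) t : ℂ) ∂m
      = ∫ t, (szego (g.1 0) t * analyticCompletion u t +
          analyticCompletion u t * conj (szego (g.1 0) t)) - analyticCompletion u t ∂m := by
        simp only [ofReal_poisson]
        congr 1
        ext t
        ring
    _ = _ := by
        rw [integral_sub (f := fun t => szego (g.1 0) t * analyticCompletion u t +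
            analyticCompletion u t * conj (szego (g.1 0) t))
          ((hk.mul_integrable hTi).add (hbc _ hTi)) hTi,
          integral_add (hk.mul_integrable hTi) (hbc _ hTi), h1, h2, ← fourierCoeff_zero
            (analyticCompletion u), hT0]
        ring

/-- The analytic completion of an invariant function `u` is invariant if `u` is orthogonal to the
imaginary part of the kernel at `g 0`. -/
theorem analyticCompletion_comp_bdry {u : Lp ℂ 2 m} (hu : ∀ᵐ t ∂m, conj (u t) = u t) (g : DiscAut)
    (hg : (fun t => u (bdry g t)) =ᵐ[m] u)
    (horth : ∫ t, u t * (szego (g.1 0) t - conj (szego (g.1 0) t)) ∂m = 0) :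
    (fun t => analyticCompletion u (bdry g t)) =ᵐ[m] analyticCompletion u := by
  have hw := norm_apply_zero_lt_one g
  have hTi := integrable_coeFn (analyticCompletion u)
  have hTg := memLp_comp_bdry g (Lp.memLp (analyticCompletion u))
  have hTgi := hTg.integrable one_le_two
  -- The real part of the completion is `u`, which is invariant, so the difference is purely
  -- imaginary. Its vanishing negative coefficients then force the positive ones to vanish.
  have hre : ∀ᵐ t ∂m, conj (analyticCompletion u (bdry g t) - analyticCompletion u t) =
      (-1) * (analyticCompletion u (bdry g t) - analyticCompletion u t) := by
    filter_upwards [analyticCompletion_add_conj hu, hg,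
      (quasiMeasurePreserving_bdry g).ae (analyticCompletion_add_conj hu)] with t h1 h2 h3
    rw [h2] at h3
    rw [map_sub]
    linear_combination h3 - h1
  have hconj : ∀ n, conj (fourierCoeff
      (fun t => analyticCompletion u (bdry g t) - analyticCompletion u t) n) =
      - fourierCoeff (fun t => analyticCompletion u (bdry g t) - analyticCompletion u t) (-n) := by
    intro n
    have := fourierCoeff_conj
      (fun t => analyticCompletion u (bdry g t) - analyticCompletion u t) (-n)
    rw [fourierCoeff_congr_ae hre, fourierCoeff.const_mul, neg_neg] at this
    rw [← this, neg_one_mul]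
  have hneg : ∀ n < 0, fourierCoeff
      (fun t => analyticCompletion u (bdry g t) - analyticCompletion u t) n = 0 := by
    intro n hn
    rw [fourierCoeff_sub_apply hTgi hTi, fourierCoeff_comp_analyticCompletion g u hn,
      fourierCoeff_analyticCompletion, if_pos hn, sub_zero]
  have hzero : fourierCoeff
      (fun t => analyticCompletion u (bdry g t) - analyticCompletion u t) 0 = 0 := by
    have hi : ∀ φ : UnitAddCircle → ℂ, Continuous φ → Integrable (fun t => u t * φ t) m := by
      intro φ hφ
      obtain ⟨K, hK⟩ := isCompact_univ.exists_bound_of_continuousOn hφ.continuousOn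
      exact (integrable_coeFn u).mul_bdd (c := K) hφ.aestronglyMeasurable
        (ae_of_all _ fun t => hK t trivial)
    have hs := continuous_szego hw
    -- Orthogonality makes this integral real. The mean of the difference is then both real and
    -- imaginary, hence zero.
    have h1 : conj (∫ t, u t * conj (szego (g.1 0) t) ∂m) =
        ∫ t, u t * conj (szego (g.1 0) t) ∂m := by
      simp only [mul_sub] at horth
      rw [integral_sub (hi _ hs) (hi (fun t => conj (szego (g.1 0) t)) (continuous_conj.comp hs)),
        sub_eq_zero] at horth
      rw [← horth, ← integral_conj, horth]
      refine integral_congr_ae ?_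
      filter_upwards [hu] with t ht
      rw [map_mul, ht]
    have hu0 : conj (fourierCoeff u 0) = fourierCoeff u 0 := by
      have := fourierCoeff_conj u 0
      rw [fourierCoeff_congr_ae hu, neg_zero] at this
      exact this.symm
    have h2 := hconj 0
    rw [neg_zero] at h2
    have h3 : fourierCoeff
        (fun t => analyticCompletion u (bdry g t) - analyticCompletion u t) 0 =
        2 * ∫ t, u t * conj (szego (g.1 0) t) ∂m - fourierCoeff u 0 - fourierCoeff u 0 := by
      rw [fourierCoeff_sub_apply hTgi hTi, fourierCoeff_zero_comp_analyticCompletion hu,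
        fourierCoeff_analyticCompletion, if_neg (lt_irrefl _), if_pos rfl]
    rw [h3, map_sub, map_sub, map_mul, h1, hu0, map_ofNat] at h2
    rw [h3]
    linear_combination h2 / 2
  have h := ae_eq_zero_of_fourierCoeff_eq_zero (hTg.sub (Lp.memLp _)) fun n => by
    rcases lt_trichotomy n 0 with hn | rfl | hn
    · exact hneg n hn
    · exact hzero
    · have := hconj n
      rw [hneg (-n) (by lia), neg_zero, map_eq_zero] at this
      exact this
  filter_upwards [h] with t ht
  exact sub_eq_zero.1 ht


/-! ### Invariant functions, the defect space and the correction. -/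

/-- A function fixed by `Γ` is measurable with respect to the invariant `σ`-algebra. -/
theorem aestronglyMeasurable_invariantSigma {Γ : Subgroup DiscAut} {f : UnitAddCircle → ℂ}
    (hf : AEStronglyMeasurable f m) (h : ∀ γ ∈ Γ, (fun t => f (bdry γ t)) =ᵐ[m] f) :
    AEStronglyMeasurable[invariantSigma Γ] f m := by
  have hmk := hf.stronglyMeasurable_mk.measurable
  refine ⟨hf.mk f, ?_, hf.ae_eq_mk⟩
  refine Measurable.stronglyMeasurable fun s hs => ?_
  refine ⟨hmk hs, fun γ hγ => ?_⟩
  have h1 : (fun t => hf.mk f (bdry γ t)) =ᵐ[m] hf.mk f :=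
    ((quasiMeasurePreserving_bdry γ).ae_eq_comp hf.ae_eq_mk.symm).trans ((h γ hγ).trans hf.ae_eq_mk)
  rw [measure_symmDiff_eq_zero_iff]
  filter_upwards [h1] with t ht
  change (hf.mk f t ∈ s) = (hf.mk f (bdry γ t) ∈ s)
  rw [ht]

/-- `Ψ` is symmetric. -/
theorem integral_mul_Psi {Γ : Subgroup DiscAut} {f φ : UnitAddCircle → ℂ}
    (hf : Integrable f m) (h : ∀ γ ∈ Γ, (fun t => f (bdry γ t)) =ᵐ[m] f) (hφ : Continuous φ) :
    ∫ t, f t * Psi Γ φ t ∂m = ∫ t, f t * φ t ∂m := by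
  obtain ⟨K, hK⟩ := isCompact_univ.exists_bound_of_continuousOn hφ.continuousOn
  have hi : Integrable (fun t => f t * φ t) m :=
    hf.mul_bdd (c := K) hφ.aestronglyMeasurable (ae_of_all _ fun t => hK t trivial)
  have := condExp_bilin_of_aestronglyMeasurable_left (ContinuousLinearMap.mul ℝ ℂ)
    (aestronglyMeasurable_invariantSigma hf.aestronglyMeasurable h) hi (integrable_of_continuous hφ)
  exact (integral_congr_ae this.symm).trans (integral_condExp (invariantSigma_le Γ))

theorem ae_norm_Psi_le (Γ : Subgroup DiscAut) {φ : UnitAddCircle → ℂ} {K : ℝ}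
    (hK : ∀ t, ‖φ t‖ ≤ K) : ∀ᵐ t ∂m, ‖Psi Γ φ t‖ ≤ K := by
  have h := ae_bdd_abs_condExp_of_ae_bdd_abs (m := invariantSigma Γ) (μ := m) (R := K)
    (f := fun t => ‖φ t‖) (ae_of_all _ fun t => by rw [abs_norm]; exact hK t)
  filter_upwards [h, norm_condExp_le (μ := m) (m := invariantSigma Γ) φ] with t h1 h2
  exact h2.trans ((le_abs_self _).trans h1)

/-- The kernel whose projection spans the defect space. -/
theorem continuous_szego_sub_conj (γ : DiscAut) :
    Continuous fun t => szego (γ.1 0) t - conj (szego (γ.1 0) t) :=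
  have h := continuous_szego (norm_apply_zero_lt_one γ)
  h.sub (continuous_conj.comp h)

theorem coeFn_defectVec (Γ : Subgroup DiscAut) (γ : DiscAut) : defectVec Γ γ =ᵐ[m]
    fun t => -I * Psi Γ (fun t => szego (γ.1 0) t - conj (szego (γ.1 0) t)) t :=
  AEEqFun.coeFn_mk _ _

/-- The defect space inside `L²`. -/
def defectTwo (Γ : Subgroup DiscAut) : Submodule ℂ (Lp ℂ 2 m) :=
  (defectSpace Γ).comap (Lp.LpSubmodule ℂ ℂ 2 m).subtype

/-- The kernels are continuous on the compact circle and `Psi` does not increase a uniform bound. -/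
theorem ae_bounded_of_mem_defectSpace {Γ : Subgroup DiscAut} {v : UnitAddCircle →ₘ[m] ℂ}
    (hv : v ∈ defectSpace Γ) : (∃ K : ℝ, ∀ᵐ t ∂m, ‖v t‖ ≤ K) := by
  induction hv using Submodule.span_induction with
  | mem v hv =>
    obtain ⟨γ, -, rfl⟩ := hv
    obtain ⟨K, hK⟩ := isCompact_univ.exists_bound_of_continuousOn
      (continuous_szego_sub_conj γ).continuousOn
    refine ⟨K, ?_⟩
    filter_upwards [coeFn_defectVec Γ γ, ae_norm_Psi_le Γ fun t => hK t trivial] with t h1 h2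
    simpa [h1] using h2
  | zero => exact ⟨0, by filter_upwards [AEEqFun.coeFn_zero (μ := m) (β := ℂ)] with t ht; simp [ht]⟩
  | add v w _ _ hv hw =>
    obtain ⟨K, hK⟩ := hv
    obtain ⟨L, hL⟩ := hw
    refine ⟨K + L, ?_⟩
    filter_upwards [hK, hL, AEEqFun.coeFn_add v w] with t h1 h2 h3
    rw [h3]
    exact (norm_add_le _ _).trans (add_le_add h1 h2)
  | smul c v _ hv =>
    obtain ⟨K, hK⟩ := hv
    refine ⟨‖c‖ * K, ?_⟩
    filter_upwards [hK, AEEqFun.coeFn_smul c v] with t h1 h2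
    rw [h2, Pi.smul_apply, norm_smul]
    gcongr

/-- Preimages of sets in a countable basis of ℂ are invariant up to null sets. Off one common null
set, no basic set separates the values at `t` and `bdry γ t`. -/
theorem comp_bdry_Psi (Γ : Subgroup DiscAut) {γ : DiscAut} (hγ : γ ∈ Γ) (φ : UnitAddCircle → ℂ) :
    (fun t => Psi Γ φ (bdry γ t)) =ᵐ[m] Psi Γ φ := by
  have hmeas : Measurable[invariantSigma Γ] (Psi Γ φ) := stronglyMeasurable_condExp.measurable
  have h : ∀ s ∈ TopologicalSpace.countableBasis ℂ,
      ∀ᵐ t ∂m, Psi Γ φ t ∈ s ↔ Psi Γ φ (bdry γ t) ∈ s := by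
    intro s hs
    have h1 := (hmeas (TopologicalSpace.isOpen_of_mem_countableBasis hs).measurableSet).2 γ hγ
    rw [measure_symmDiff_eq_zero_iff] at h1
    filter_upwards [h1] with t ht
    exact iff_of_eq ht
  filter_upwards [(ae_ball_iff (TopologicalSpace.countable_countableBasis ℂ)).2 h] with t ht
  exact (((TopologicalSpace.isBasis_countableBasis ℂ).inseparable_iff).2 ht).eq.symm

theorem comp_bdry_of_mem_defectSpace {Γ : Subgroup DiscAut} {v : UnitAddCircle →ₘ[m] ℂ}
    (hv : v ∈ defectSpace Γ) {γ : DiscAut} (hγ : γ ∈ Γ) : (fun t => v (bdry γ t)) =ᵐ[m] v := by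
  have hq := quasiMeasurePreserving_bdry γ
  induction hv using Submodule.span_induction with
  | mem v hv =>
    obtain ⟨δ, -, rfl⟩ := hv
    filter_upwards [coeFn_defectVec Γ δ, hq.ae (coeFn_defectVec Γ δ), comp_bdry_Psi Γ hγ
      (fun t => szego (δ.1 0) t - conj (szego (δ.1 0) t))] with t h1 h2 h3
    rw [h2, h3, h1]
  | zero =>
    have h0 := AEEqFun.coeFn_zero (μ := m) (α := UnitAddCircle) (β := ℂ)
    filter_upwards [h0, hq.ae h0] with t h1 h2
    rw [h1, h2]
    rfl
  | add v w _ _ hv hw =>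
    have h0 := AEEqFun.coeFn_add v w
    filter_upwards [hv, hw, h0, hq.ae h0] with t h1 h2 h3 h4
    rw [h3, h4, Pi.add_apply, Pi.add_apply, h1, h2]
  | smul c v _ hv =>
    have h0 := AEEqFun.coeFn_smul c v
    filter_upwards [hv, h0, hq.ae h0] with t h1 h2 h3
    rw [h2, h3, Pi.smul_apply, Pi.smul_apply, h1]

theorem finiteDimensional_defectTwo {Γ : Subgroup DiscAut} (h : FiniteDimensional ℂ (defectSpace Γ)) :
    FiniteDimensional ℂ (defectTwo Γ) :=
  FiniteDimensional.of_injective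
    (((Lp.LpSubmodule ℂ ℂ 2 m).subtype.restrict (p := defectTwo Γ) (q := defectSpace Γ)
      fun _ hx => hx) : defectTwo Γ →ₗ[ℂ] defectSpace Γ)
    fun x y hxy => by
      have := congrArg Subtype.val hxy
      exact Subtype.ext (Subtype.ext this)

/-- On the defect space the sup norm is dominated by the `L²` norm. -/
theorem exists_bound_defectTwo {Γ : Subgroup DiscAut} (h : FiniteDimensional ℂ (defectSpace Γ)) :
    ∃ K : ℝ, ∀ v ∈ defectTwo Γ, ∀ᵐ t ∂m, ‖v t‖ ≤ K * ‖v‖ := by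
  have := finiteDimensional_defectTwo h
  let b := Module.finBasis ℂ (defectTwo Γ)
  choose C hC using fun i => ae_bounded_of_mem_defectSpace (Submodule.mem_comap.1 (b i).2)
  have hC0 : ∀ i, 0 ≤ C i := fun i => by
    obtain ⟨t, ht⟩ := (hC i).exists
    exact (norm_nonneg _).trans ht
  -- Finite dimension makes the coordinate functionals continuous for the L² norm.
  let c := fun i => LinearMap.toContinuousLinearMap (b.coord i)
  refine ⟨∑ i, ‖c i‖ * C i, fun v hv => ?_⟩
  have hsum : v = ∑ i, b.coord i ⟨v, hv⟩ • (b i : Lp ℂ 2 m) := by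
    have := congrArg (defectTwo Γ).subtype (b.sum_repr ⟨v, hv⟩)
    rw [map_sum] at this
    exact this.symm
  have hcoe : v =ᵐ[m] fun t => ∑ i, b.coord i ⟨v, hv⟩ * (b i : Lp ℂ 2 m) t := by
    conv_lhs => rw [hsum]
    refine (Lp.coeFn_finsetSum _ _).trans ?_
    have h1 : ∀ i, _ := fun i => Lp.coeFn_smul (b.coord i ⟨v, hv⟩) (b i : Lp ℂ 2 m)
    filter_upwards [ae_all_iff.2 h1] with t ht
    rw [Finset.sum_apply]
    exact Finset.sum_congr rfl fun i _ => ht i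
  filter_upwards [hcoe, ae_all_iff.2 hC] with t h1 h2
  rw [h1, Finset.sum_mul]
  refine (norm_sum_le _ _).trans (Finset.sum_le_sum fun i _ => ?_)
  rw [norm_mul, mul_right_comm]
  have h3 : ‖b.coord i ⟨v, hv⟩‖ ≤ ‖c i‖ * ‖v‖ := (c i).le_opNorm ⟨v, hv⟩
  have h4 := hC0 i
  exact mul_le_mul h3 (h2 i) (norm_nonneg _) (by positivity)

/-- An invariant real `u ∈ L²` can be made orthogonal to the kernels by subtracting a bounded
real invariant function of size `O(‖u‖)`. -/
theorem exists_correction {Γ : Subgroup DiscAut} (h : FiniteDimensional ℂ (defectSpace Γ)) :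
    ∃ K : ℝ, 0 ≤ K ∧ ∀ u : Lp ℂ 2 m, (∀ᵐ t ∂m, conj (u t) = u t) →
      (∀ γ ∈ Γ, (fun t => u (bdry γ t)) =ᵐ[m] u) →
      ∃ w : Lp ℂ 2 m, (∀ᵐ t ∂m, conj (w t) = w t) ∧ (∀ γ ∈ Γ, (fun t => w (bdry γ t)) =ᵐ[m] w) ∧
        (∀ γ ∈ Γ, ∫ t, w t * (szego (γ.1 0) t - conj (szego (γ.1 0) t)) ∂m = 0) ∧
        ∀ᵐ t ∂m, ‖w t - u t‖ ≤ K * ‖u‖ := by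
  have := finiteDimensional_defectTwo h
  obtain ⟨K, hK⟩ := exists_bound_defectTwo h
  refine ⟨max K 0, le_max_right _ _, fun u hu hinv => ?_⟩
  let P := (defectTwo Γ).starProjection u
  have hP : P ∈ defectTwo Γ := Submodule.starProjection_apply_mem _ u
  have hsub := Lp.coeFn_sub u P
  -- The projection `P` may be complex-valued, so the real part of `u - P` is taken. The kernels k -
  -- conj k are purely imaginary, so orthogonality survives conjugation and hence taking real parts.
  have hre : MemLp (fun t => (((u - P : Lp ℂ 2 m) t).re : ℂ)) 2 m := (Lp.memLp (u - P)).re.ofReal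
  have hsinv : ∀ γ ∈ Γ, (fun t => (u - P : Lp ℂ 2 m) (bdry γ t)) =ᵐ[m] (u - P : Lp ℂ 2 m) := by
    intro γ hγ
    filter_upwards [hsub, (quasiMeasurePreserving_bdry γ).ae hsub, hinv γ hγ,
      comp_bdry_of_mem_defectSpace (Submodule.mem_comap.1 hP) hγ] with t h1 h2 h3 h4
    rw [h1, h2, Pi.sub_apply, Pi.sub_apply, h3]
    exact congrArg (u t - ·) h4
  have hsi := integrable_coeFn (u - P)
  have hci : Integrable (fun t => conj ((u - P : Lp ℂ 2 m) t)) m :=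
    (Lp.memLp (u - P)).star.integrable one_le_two
  refine ⟨hre.toLp _, ?_, fun γ hγ => ?_, fun γ hγ => ?_, ?_⟩
  · filter_upwards [hre.coeFn_toLp] with t ht
    rw [ht, conj_ofReal]
  · filter_upwards [hre.coeFn_toLp, (quasiMeasurePreserving_bdry γ).ae hre.coeFn_toLp,
      hsinv γ hγ] with t h1 h2 h3
    rw [h1, h2, h3]
  · have hφ := continuous_szego_sub_conj γ
    set φ := fun t => szego (γ.1 0) t - conj (szego (γ.1 0) t) with hφdef
    have hφc : ∀ t, conj (φ t) = -φ t := fun t => by simp [hφdef]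
    have hcinv : ∀ γ ∈ Γ, (fun t => conj ((u - P : Lp ℂ 2 m) (bdry γ t))) =ᵐ[m]
        fun t => conj ((u - P : Lp ℂ 2 m) t) := fun γ hγ => by
      filter_upwards [hsinv γ hγ] with t ht
      rw [ht]
    obtain ⟨L, hL⟩ := isCompact_univ.exists_bound_of_continuousOn hφ.continuousOn
    have hbi : ∀ f : UnitAddCircle → ℂ, Integrable f m → Integrable (fun t => f t * φ t) m :=
      fun f hf => hf.mul_bdd (c := L) hφ.aestronglyMeasurable (ae_of_all _ fun t => hL t trivial)
    have hv : MemLp (defectVec Γ γ) 2 m := by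
      obtain ⟨C, hC⟩ := ae_bounded_of_mem_defectSpace
        (Submodule.subset_span ⟨γ, hγ, rfl⟩ : defectVec Γ γ ∈ defectSpace Γ)
      exact MemLp.of_bound (AEEqFun.aestronglyMeasurable _) C hC
    have hvm : hv.toLp _ ∈ defectTwo Γ := by
      refine Submodule.mem_comap.2 ?_
      have : (Lp.LpSubmodule ℂ ℂ 2 m).subtype (hv.toLp _) = defectVec Γ γ :=
        AEEqFun.mk_coeFn _
      exact (congrArg (· ∈ defectSpace Γ) this).mpr (Submodule.subset_span ⟨γ, hγ, rfl⟩)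
    have horth : ∫ t, conj ((u - P : Lp ℂ 2 m) t) * φ t ∂m = 0 := by
      have h1 := Submodule.sub_starProjection_mem_orthogonal (K := defectTwo Γ) u _ hvm
      rw [L2.inner_def] at h1
      -- Orthogonality to v_γ = -iΨφ. Since `u - P` is invariant, Ψ can then be dropped by symmetry.
      have h2 : ∫ t, conj ((u - P : Lp ℂ 2 m) t) * Psi Γ φ t ∂m = 0 := by
        rw [← map_eq_zero (starRingEnd ℂ), ← integral_conj,
          ← mul_right_inj' (I_ne_zero), mul_zero, ← h1, ← integral_const_mul]
        refine integral_congr_ae ?_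
        filter_upwards [hv.coeFn_toLp, coeFn_defectVec Γ γ] with t h3 h4
        rw [h3, h4]
        simp only [RCLike.inner_apply, map_mul, map_neg, conj_I, conj_conj]
        ring
      rw [← h2, integral_mul_Psi hci hcinv hφ]
    have horth' : ∫ t, (u - P : Lp ℂ 2 m) t * φ t ∂m = 0 := by
      have h1 := congrArg conj horth
      rw [← integral_conj, map_zero] at h1
      simp only [map_mul, conj_conj, hφc, mul_neg, integral_neg, neg_eq_zero] at h1
      exact h1
    have h2 : ∫ t, (hre.toLp _ : Lp ℂ 2 m) t * φ t ∂m =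
        ∫ t, 2⁻¹ * ((u - P : Lp ℂ 2 m) t * φ t + conj ((u - P : Lp ℂ 2 m) t) * φ t) ∂m := by
      refine integral_congr_ae ?_
      filter_upwards [hre.coeFn_toLp] with t ht
      rw [ht, re_eq_add_conj]
      ring
    rw [h2, integral_const_mul, integral_add (hbi _ hsi) (hbi _ hci), horth, horth']
    simp
  -- As `u` is real, the correction is -Re P, bounded by the sup norm of `P`.
  · filter_upwards [hre.coeFn_toLp, hu, hsub, hK P hP] with t h1 h2 h3 h4
    obtain ⟨r, hr⟩ := conj_eq_iff_real.1 h2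
    rw [h1, h3, Pi.sub_apply, hr, sub_re, ofReal_re, ofReal_sub, sub_sub_cancel_left, norm_neg,
      norm_real]
    refine (abs_re_le_norm _).trans (h4.trans ?_)
    gcongr
    · exact le_max_left _ _
    · exact Submodule.norm_starProjection_apply_le _ u


/-! ### Closedness of H^p_Γ and approximation by bounded functions. -/

/-- The space `H^p_Γ` is a closed subspace of `L^p`. -/
def hardyFixSubmodule (Γ : Subgroup DiscAut) (p : ℝ≥0∞) [Fact (1 ≤ p)] :
    Submodule ℂ (Lp ℂ p m) where
  carrier := HardyFix Γ p
  zero_mem' := by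
    refine ⟨fun n _ => ?_, fun γ _ => (compL_eq_self_iff p γ 0).1 (map_zero _)⟩
    rw [fourierCoeff_congr_ae (Lp.coeFn_zero ℂ p m)]
    simp [fourierCoeff]
  add_mem' {f g} hf hg := by
    refine ⟨fun n hn => ?_, fun γ hγ => (compL_eq_self_iff p γ _).1 ?_⟩
    · rw [fourierCoeff_congr_ae (Lp.coeFn_add f g),
        fourierCoeff.add (integrable_coeFn f) (integrable_coeFn g), Pi.add_apply, hf.1 n hn,
        hg.1 n hn, add_zero]
    · rw [map_add, (compL_eq_self_iff p γ f).2 (hf.2 γ hγ), (compL_eq_self_iff p γ g).2 (hg.2 γ hγ)]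
  smul_mem' c f hf := by
    refine ⟨fun n hn => ?_, fun γ hγ => (compL_eq_self_iff p γ _).1 ?_⟩
    · rw [fourierCoeff_congr_ae (Lp.coeFn_smul c f), fourierCoeff.const_smul, hf.1 n hn, smul_zero]
    · rw [map_smul, (compL_eq_self_iff p γ f).2 (hf.2 γ hγ)]

theorem isClosed_hardyFix (Γ : Subgroup DiscAut) (p : ℝ≥0∞) [Fact (1 ≤ p)] :
    IsClosed (HardyFix Γ p) := by
  have h : HardyFix Γ p = (⋂ (n : ℤ) (_ : n < 0), {f : Lp ℂ p m | fourierCoeff f n = 0}) ∩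
      ⋂ γ ∈ Γ, {f : Lp ℂ p m | compL p γ f = f} := by
    ext f : 1
    simp only [HardyFix, Hardy, Set.mem_ofPred_eq, Set.mem_inter_iff, Set.mem_iInter,
      compL_eq_self_iff]
  rw [h]
  refine (isClosed_iInter fun n => isClosed_iInter fun _ => ?_).inter
    (isClosed_iInter fun γ => isClosed_iInter fun _ => ?_)
  · exact isClosed_eq (continuous_fourierCoeff p n) continuous_const
  · exact isClosed_eq (compL p γ).continuous continuous_id

theorem hardyFixInfty_subset (Γ : Subgroup DiscAut) (p : ℝ≥0∞) :
    HardyFixInfty Γ p ⊆ HardyFix Γ p := by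
  rintro f ⟨g, ⟨hg1, hg2⟩, hfg⟩
  refine ⟨fun n hn => ?_, fun γ hγ => ?_⟩
  · rw [fourierCoeff_congr_ae hfg]
    exact hg1 n hn
  · exact ((quasiMeasurePreserving_bdry γ).ae_eq_comp hfg).trans ((hg2 γ hγ).trans hfg.symm)

theorem closedSpan_hardyFixInfty_subset (Γ : Subgroup DiscAut) (p : ℝ≥0∞) [Fact (1 ≤ p)] :
    (closedSpan (HardyFixInfty Γ p) : Set (Lp ℂ p m)) ⊆ HardyFix Γ p :=
  closure_minimal (Submodule.span_le (p := hardyFixSubmodule Γ p).2 (hardyFixInfty_subset Γ p))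
    (isClosed_hardyFix Γ p)

/-- Follows from log x = 2 log √x ≤ 2√x. It bounds the L² norm of log⁺ by an L¹ norm, so the
argument already works at p = 1. -/
theorem sq_posLog_le {x : ℝ} (hx : 0 ≤ x) : (Real.posLog x) ^ 2 ≤ 4 * x := by
  rcases le_or_gt x 1 with h | h
  · rw [Real.posLog_eq_zero_iff x |>.2 (by rwa [abs_of_nonneg hx])]
    simpa using hx
  · have h1 : Real.log x ≤ 2 * √x := by
      have := Real.log_le_self (Real.sqrt_nonneg x)
      rw [Real.log_sqrt hx] at this
      linarith
    rw [Real.posLog_eq_log (by rw [abs_of_nonneg hx]; exact h.le)]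
    calc Real.log x ^ 2 ≤ (2 * √x) ^ 2 := pow_le_pow_left₀ (Real.log_nonneg h.le) h1 2
      _ = 4 * x := by rw [mul_pow, Real.sq_sqrt hx]; norm_num

theorem mul_exp_neg_posLog_le {x : ℝ} (hx : 0 ≤ x) : x * Real.exp (-Real.posLog x) ≤ 1 := by
  rw [Real.exp_neg, ← div_eq_mul_inv, div_le_one (Real.exp_pos _)]
  rcases hx.eq_or_lt with rfl | h
  · exact (Real.exp_pos _).le
  · exact (Real.exp_log h).symm.le.trans (Real.exp_le_exp.2 (le_max_right _ _))

theorem norm_sq_eq_integral (u : Lp ℂ 2 m) : ‖u‖ ^ 2 = ∫ t, ‖u t‖ ^ 2 ∂m := by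
  have h : ((‖u‖ ^ 2 : ℝ) : ℂ) = ((∫ t, ‖u t‖ ^ 2 ∂m : ℝ) : ℂ) := by
    rw [← integral_complex_ofReal]
    have h1 := inner_self_eq_norm_sq_to_K (𝕜 := ℂ) u
    rw [L2.inner_def] at h1
    simp only [inner_self_eq_norm_sq_to_K] at h1
    push_cast
    exact h1.symm
  exact ofReal_inj.1 h

/-- Dominated convergence in `L^p`. -/
theorem tendsto_Lp_of_dominated {p : ℝ≥0∞} [hp1 : Fact (1 ≤ p)] (hp : p ≠ ∞)
    {F : ℕ → Lp ℂ p m} {f G : Lp ℂ p m} (C : ℝ) (hb : ∀ k, ∀ᵐ t ∂m, ‖F k t‖ ≤ C * ‖G t‖)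
    (hlim : ∀ᵐ t ∂m, Tendsto (fun k => F k t) atTop (𝓝 (f t))) : Tendsto F atTop (𝓝 f) := by
  have hp0 : p ≠ 0 := (zero_lt_one.trans_le hp1.out).ne'
  have hpos : 0 < p.toReal := ENNReal.toReal_pos hp0 hp
  rw [Lp.tendsto_Lp_iff_tendsto_eLpNorm']
  have hG : MemLp (fun t => ((2 * C : ℝ) : ℂ) * G t) p m := (Lp.memLp G).const_mul _
  have hbound : ∀ k, ∀ᵐ t ∂m, ‖F k t - f t‖ₑ ≤ ‖((2 * C : ℝ) : ℂ) * G t‖ₑ := fun k => by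
    filter_upwards [ae_all_iff.2 hb, hlim] with t h1 h2
    have h3 : ‖f t‖ ≤ C * ‖G t‖ := le_of_tendsto h2.norm (Eventually.of_forall h1)
    rw [enorm_le_iff_norm_le, norm_mul, norm_real]
    refine (norm_sub_le _ _).trans ((add_le_add (h1 k) h3).trans ?_)
    rw [← add_mul, ← two_mul]
    gcongr
    exact Real.le_norm_self _
  have h0 : Tendsto (fun k => ∫⁻ t, ‖F k t - f t‖ₑ ^ p.toReal ∂m) atTop (𝓝 0) := by
    have h := tendsto_lintegral_of_dominated_convergence' (μ := m)
      (F := fun k t => ‖F k t - f t‖ₑ ^ p.toReal) (f := 0)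
      (fun t => ‖((2 * C : ℝ) : ℂ) * G t‖ₑ ^ p.toReal)
      (fun k => (((Lp.aestronglyMeasurable (F k)).sub
        (Lp.aestronglyMeasurable f)).enorm).pow_const _)
      (fun k => by
        filter_upwards [hbound k] with t ht
        exact ENNReal.rpow_le_rpow ht hpos.le)
      (lintegral_rpow_enorm_lt_top_of_eLpNorm_lt_top hp0 hp hG.2).ne ?_
    · simpa using h
    · filter_upwards [hlim] with t ht
      have h1 : Tendsto (fun k => ‖F k t - f t‖ₑ) atTop (𝓝 0) := by
        have := (ht.sub_const (f t)).enorm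
        rwa [sub_self, enorm_zero] at this
      have h2 := (ENNReal.continuous_rpow_const (y := p.toReal)).tendsto 0 |>.comp h1
      rwa [ENNReal.zero_rpow_of_pos hpos] at h2
  have h1 := (ENNReal.continuous_rpow_const (y := 1 / p.toReal)).tendsto 0 |>.comp h0
  rw [ENNReal.zero_rpow_of_pos (by positivity)] at h1
  refine h1.congr fun k => ?_
  rw [eLpNorm_eq_lintegral_rpow_enorm_toReal hp0 hp]
  rfl

theorem hardyFix_subset_closedSpan {Γ : Subgroup DiscAut}
    (h : FiniteDimensional ℂ (defectSpace Γ)) {p : ℝ≥0∞} [Fact (1 ≤ p)] (hp : p ≠ ∞) :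
    HardyFix Γ p ⊆ closedSpan (HardyFixInfty Γ p) := by
  intro f hf
  obtain ⟨K, hK0, hK⟩ := exists_correction h
  have hfi := integrable_coeFn f
  have hfm := Lp.aestronglyMeasurable f
  let x : ℕ → UnitAddCircle → ℝ := fun n t => ‖f t‖ / (n + 1)
  have hx0 : ∀ n t, 0 ≤ x n t := fun n t => by positivity
  have hxm : ∀ n, AEStronglyMeasurable (fun t => Real.posLog (x n t)) m := fun n =>
    Real.continuous_posLog.comp_aestronglyMeasurable
      (hfm.norm.aemeasurable.div_const _).aestronglyMeasurable
  have hxi : ∀ n, Integrable (x n) m := fun n => hfi.norm.div_const _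
  have hv2 : ∀ n, MemLp (fun t => ((-Real.posLog (x n t) : ℝ) : ℂ)) 2 m := fun n => by
    refine MemLp.ofReal (MemLp.neg ?_)
    rw [memLp_two_iff_integrable_sq (hxm n)]
    refine ((hxi n).const_mul 4).mono' ((hxm n).pow 2) (ae_of_all _ fun t => ?_)
    rw [Real.norm_eq_abs, abs_of_nonneg (sq_nonneg _)]
    exact sq_posLog_le (hx0 n t)
  let u : ℕ → Lp ℂ 2 m := fun n => (hv2 n).toLp _
  have hucoe : ∀ n, u n =ᵐ[m] fun t => ((-Real.posLog (x n t) : ℝ) : ℂ) := fun n =>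
    (hv2 n).coeFn_toLp
  -- Dividing `f` by n + 1 is what makes this tend to zero.
  have hunorm : ∀ n, ‖u n‖ ^ 2 ≤ 4 * (∫ t, ‖f t‖ ∂m) * (1 / ((n : ℝ) + 1)) := fun n => by
    calc ‖u n‖ ^ 2 = ∫ t, ‖u n t‖ ^ 2 ∂m := norm_sq_eq_integral (u n)
      _ ≤ ∫ t, 4 * x n t ∂m := by
        refine integral_mono_of_nonneg (ae_of_all _ fun t => by positivity)
          ((hxi n).const_mul 4) ?_
        filter_upwards [hucoe n] with t ht
        rw [ht, norm_real, norm_neg, Real.norm_eq_abs, sq_abs]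
        exact sq_posLog_le (hx0 n t)
      _ = _ := by
        rw [integral_const_mul, integral_div]
        ring
  have hu0 : Tendsto u atTop (𝓝 0) := by
    rw [tendsto_zero_iff_norm_tendsto_zero]
    have h1 : Tendsto (fun n => ‖u n‖ ^ 2) atTop (𝓝 0) := by
      refine squeeze_zero (fun _ => sq_nonneg _) hunorm ?_
      simpa using (tendsto_one_div_add_atTop_nhds_zero_nat (𝕜 := ℝ)).const_mul
        (4 * (∫ t, ‖f t‖ ∂m))
    have h2 := (Real.continuous_sqrt.tendsto 0).comp h1
    simpa [Function.comp_def, Real.sqrt_sq (norm_nonneg _)] using h2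
  have hureal : ∀ n, ∀ᵐ t ∂m, conj (u n t) = u n t := fun n => by
    filter_upwards [hucoe n] with t ht
    rw [ht, conj_ofReal]
  have huinv : ∀ n, ∀ γ ∈ Γ, (fun t => u n (bdry γ t)) =ᵐ[m] u n := fun n γ hγ => by
    filter_upwards [hucoe n, (quasiMeasurePreserving_bdry γ).ae (hucoe n), hf.2 γ hγ]
      with t h1 h2 h3
    simp only [h1, h2, x, h3]
  choose w hwreal hwinv hworth hwu using fun n => hK (u n) (hureal n) (huinv n)
  have hw0 : Tendsto w atTop (𝓝 0) := by
    have h1 : Tendsto (fun n => w n - u n) atTop (𝓝 0) := by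
      refine squeeze_zero_norm (a := fun n => K * ‖u n‖) (fun n => ?_) ?_
      · have := Lp.norm_le_of_ae_bound (f := w n - u n) (C := K * ‖u n‖) (by positivity) (by
          filter_upwards [hwu n, Lp.coeFn_sub (w n) (u n)] with t h1 h2
          rw [h2]
          exact h1)
        simpa [measureUnivNNReal] using this
      · simpa using (tendsto_zero_iff_norm_tendsto_zero.1 hu0).const_mul K
    simpa using h1.add hu0
  obtain ⟨M, hM⟩ : ∃ M, ∀ n, K * ‖u n‖ ≤ M := by
    obtain ⟨M, hM⟩ := (tendsto_zero_iff_norm_tendsto_zero.1 hu0).bddAbove_range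
    exact ⟨K * M, fun n => by gcongr; exact hM ⟨n, rfl⟩⟩
  -- The correction costs at most the constant `M`, uniformly in `n`, and leaves the decay -log⁺
  -- intact.
  have hwre : ∀ n, ∀ᵐ t ∂m, (w n t).re ≤ M - Real.posLog (x n t) := fun n => by
    filter_upwards [hwu n, hucoe n] with t h1 h2
    have h3 := (re_le_norm _).trans (h1.trans (hM n))
    rw [h2, sub_re, ofReal_re] at h3
    linarith
  have hwM : ∀ n, ∀ᵐ t ∂m, (w n t).re ≤ M := fun n => by
    filter_upwards [hwre n] with t ht
    have : 0 ≤ Real.posLog (x n t) := Real.posLog_nonneg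
    linarith
  have hF := fun n => isMultiplier_exp_analyticCompletion (hwreal n) (hwM n)
  have hFnorm : ∀ n, ∀ᵐ t ∂m, ‖exp (analyticCompletion (w n) t)‖ ≤
      Real.exp M * Real.exp (-Real.posLog (x n t)) := fun n => by
    filter_upwards [re_analyticCompletion (hwreal n), hwre n] with t h1 h2
    rw [norm_exp, h1, ← Real.exp_add]
    exact Real.exp_le_exp.2 (by linarith)
  have hFM : ∀ n, ∀ᵐ t ∂m, ‖exp (analyticCompletion (w n) t)‖ ≤ Real.exp M := fun n => by
    filter_upwards [re_analyticCompletion (hwreal n), hwM n] with t h1 h2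
    rw [norm_exp, h1]
    exact Real.exp_le_exp.2 h2
  have hFinv : ∀ n, ∀ γ ∈ Γ, (fun t => analyticCompletion (w n) (bdry γ t)) =ᵐ[m]
      analyticCompletion (w n) := fun n γ hγ =>
    analyticCompletion_comp_bdry (hwreal n) γ (hwinv n γ hγ) (hworth n γ hγ)
  have hmeas : ∀ n, AEStronglyMeasurable (fun t => exp (analyticCompletion (w n) t) * f t) m :=
    fun n => (hF n).aestronglyMeasurable.mul hfm
  have htop : ∀ n, MemLp (fun t => exp (analyticCompletion (w n) t) * f t) ∞ m := fun n => by
    refine memLp_top_of_bound (hmeas n) (Real.exp M * (n + 1)) ?_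
    filter_upwards [hFnorm n] with t ht
    rw [norm_mul]
    have h1 : ‖f t‖ = x n t * (n + 1) := by
      simp only [x]
      field_simp
    -- The factor exp(-log⁺ x) absorbs x = |f|/(n+1), leaving the bound exp(M) (n+1).
    calc _ ≤ (Real.exp M * Real.exp (-Real.posLog (x n t))) * (x n t * (n + 1)) := by
          rw [← h1]; gcongr
      _ = Real.exp M * ((x n t * Real.exp (-Real.posLog (x n t))) * (n + 1)) := by ring
      _ ≤ Real.exp M * (1 * (n + 1)) := by gcongr; exact mul_exp_neg_posLog_le (hx0 n t)
      _ = _ := by rw [one_mul]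
  have hLp : ∀ n, MemLp (fun t => exp (analyticCompletion (w n) t) * f t) p m := fun n =>
    (htop n).mono_exponent le_top
  let G : ℕ → Lp ℂ p m := fun n => (hLp n).toLp _
  have hGmem : ∀ n, G n ∈ HardyFixInfty Γ p := fun n => by
    refine ⟨(htop n).toLp _, ⟨fun k hk => ?_, fun γ hγ => ?_⟩,
      (hLp n).coeFn_toLp.trans (htop n).coeFn_toLp.symm⟩
    · rw [fourierCoeff_congr_ae (htop n).coeFn_toLp]
      exact (hF n).mul_coeff_neg hfi hf.1 hk
    · filter_upwards [(htop n).coeFn_toLp,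
        (quasiMeasurePreserving_bdry γ).ae (htop n).coeFn_toLp, hFinv n γ hγ, hf.2 γ hγ]
        with t h1 h2 h3 h4
      rw [h1, h2, h3, h4]
  have hTw : Tendsto (fun n => analyticCompletion (w n)) atTop (𝓝 0) := by
    have h1 := (analyticCompletion.continuous.tendsto 0).comp hw0
    rwa [map_zero] at h1
  obtain ⟨φ, -, hφ⟩ := exists_subseq_ae hTw
  have hlim : Tendsto (fun k => G (φ k)) atTop (𝓝 f) := by
    -- The bound exp(M) (n+1) is not uniform, so the dominating function is exp(M)|f|.
    refine tendsto_Lp_of_dominated hp (G := f) (Real.exp M) (fun k => ?_) ?_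
    · filter_upwards [(hLp (φ k)).coeFn_toLp, hFM (φ k)] with t h1 h2
      rw [h1, norm_mul]
      gcongr
    · filter_upwards [hφ, Lp.coeFn_zero ℂ 2 m, ae_all_iff.2 fun k => (hLp (φ k)).coeFn_toLp]
        with t h1 h2 h3
      rw [h2] at h1
      have h4 := ((continuous_exp.tendsto _).comp h1).mul_const (f t)
      rw [Pi.zero_apply, exp_zero, one_mul] at h4
      exact h4.congr fun k => (h3 k).symm
  exact mem_closure_of_tendsto hlim
    (Eventually.of_forall fun k => Submodule.subset_span (hGmem (φ k)))

end HardyFixed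

end

theorem proposition3p2 (Γ : Subgroup HardyFixed.DiscAut) (hΓ : HardyFixed.IsAdmissible Γ)
    (p : ℝ≥0∞) [Fact (1 ≤ p)] (hp : p ≠ ∞) :
    (HardyFixed.closedSpan (HardyFixed.HardyFixInfty Γ p) : Set (Lp ℂ p HardyFixed.m)) =
      HardyFixed.HardyFix Γ p :=
  (HardyFixed.closedSpan_hardyFixInfty_subset Γ p).antisymm
    (HardyFixed.hardyFix_subset_closedSpan hΓ.finiteDimensional hp)
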